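/- Let $k\in\mathbb R$ with $e^k+e^{-k}\in\mathbb Z\setminus\{2\}$, and let $G_k$ be the Lie group of matrices $$\begin{pmatrix} e^{kz}&0&0&x\\0&e^{-kz}&0&y\\0&0&1&z\\0&0&0&1\end{pmatrix},\qquad x,y,z\in\mathbb R .$$ Let $\Gamma\subset G_k$ be a discrete subgroup such that $N_k=G_k/\Gamma$ is compact. The right invariant forms $dx-kx\,dz$, $dy+ky\,dz$, $dz$ on $G_k$ descend to $1$-forms $\alpha,\beta,\gamma$ on $N_k$. Let $n$ be a nonzero integer, $\lambda\in\mathbb R$, and let $\pi:M_{n,k}\to N_k$ be a smooth principal bundle with group $S^1=\mathbb R/\mathbb Z$ that has a connection form $\eta$ (an invariant $1$-form equal to $1$ on the fundamental vector field) with curvature $d\eta=n\lambda\,\alpha\wedge\beta$; thus its real Chern class is $n\lambda[\alpha\wedge\beta]$. Pullbacks of $\alpha,\beta,\gamma$ to the $4$-manifold $M_{n,k}$ are denoted by the same letters. For a closed $1$-form $\omega$ put $d_\omega\theta=d\theta+\omega\wedge\theta$ and $H^p_\omega(M)=\ker d_\omega/\operatorname{im}d_\omega$ (on smooth $p$-forms).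 A non-degenerate $2$-form $\Omega$ is called locally conformal symplectic with Lee form $\omega$ if $\omega$ is a closed $1$-form and $d\Omega=-\omega\wedge\Omega$; it then has a class $[\Omega]\in H^2_\omega(M)$. (i) For all real $t_1,t_2,t_3$ with $t_1t_2\neq0$ and $t_1t_2\neq nk\lambda t_3^2$, the $2$-form $$\Omega_{(t_1,t_2,t_3)}=t_1\,\alpha\wedge\eta+t_2\,\beta\wedge\gamma+t_3\,(n\lambda\,\alpha\wedge\beta-k\,\gamma\wedge\eta)$$ on $M_{n,k}$ is locally conformal symplectic with Lee form $\omega=-k\gamma$, and $[\Omega_{(t_1,t_2,t_3)}]\neq0$ in $H^2_{\omega}(M_{n,k})$. (ii) For all real $s_1,s_2,s_3$ with $s_1s_2\neq0$ and $s_1s_2\neq nk\lambda s_3^2$, the $2$-form $$\Omega'_{(s_1,s_2,s_3)}=s_1\,\beta\wedge\eta+s_2\,\alpha\wedge\gamma+s_3\,(n\lambda\,\alpha\wedge\beta+k\,\gamma\wedge\eta)$$ on $M_{n,k}$ is locally conformal symplectic with Lee form $\omega'=k\gamma=-\omega$, and $[\Omega'_{(s_1,s_2,s_3)}]\neq0$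 in $H^2_{-\omega}(M_{n,k})$. -/

import Mathlib

open Set Manifold
open scoped Manifold ContDiff Topology

noncomputable section

namespace ACFM

/-! ### Differential forms on a smooth manifold without boundary, modelled on `E` -/

section Forms

variable {E : Type*} [NormedAddCommGroup E] [NormedSpace ℝ E]
  {M : Type*} [TopologicalSpace M] [ChartedSpace E M]
  {F : Type*} [NormedAddCommGroup F] [NormedSpace ℝ F]
  {N : Type*} [TopologicalSpace N] [ChartedSpace F N]

/-- A (not necessarily smooth) differential `p`-form on `M`. -/
def DForm (E : Type*) [NormedAddCommGroup E] [NormedSpace ℝ E]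
    (M : Type*) [TopologicalSpace M] [ChartedSpace E M] (p : ℕ) : Type _ :=
  (x : M) → TangentSpace 𝓘(ℝ, E) x [⋀^Fin p]→L[ℝ] ℝ

instance {p : ℕ} : AddCommGroup (DForm E M p) :=
  inferInstanceAs (AddCommGroup ((x : M) → TangentSpace 𝓘(ℝ, E) x [⋀^Fin p]→L[ℝ] ℝ))

instance {p : ℕ} : Module ℝ (DForm E M p) :=
  inferInstanceAs (Module ℝ ((x : M) → TangentSpace 𝓘(ℝ, E) x [⋀^Fin p]→L[ℝ] ℝ))

/-- The pullback `f^* θ` of a differential form. -/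
def pullback {p : ℕ} (f : M → N) (θ : DForm F N p) : DForm E M p := fun x =>
  (θ (f x)).compContinuousLinearMap (mfderiv 𝓘(ℝ, E) 𝓘(ℝ, F) f x)

/-- The expression of `θ` in the preferred chart around `x`: the pullback of `θ` under the inverse
of that chart, a form on the open subset `(extChartAt 𝓘(ℝ, E) x).target` of `E`. -/
def chartRep {p : ℕ} (θ : DForm E M p) (x : M) : E → E [⋀^Fin p]→L[ℝ] ℝ :=
  pullback (E := E) (M := E) (extChartAt 𝓘(ℝ, E) x).symm θ

/-- A form is smooth if its expressions in the charts are. -/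
def IsSmoothForm {p : ℕ} (θ : DForm E M p) : Prop :=
  ∀ x : M, ContDiffOn ℝ ∞ (chartRep θ x) (extChartAt 𝓘(ℝ, E) x).target

/-- The exterior derivative, computed in the preferred chart around each point. -/
def extD {p : ℕ} (θ : DForm E M p) : DForm E M (p + 1) := fun x =>
  (extDeriv (chartRep θ x) (extChartAt 𝓘(ℝ, E) x x)).compContinuousLinearMap
    (mfderiv 𝓘(ℝ, E) 𝓘(ℝ, E) (extChartAt 𝓘(ℝ, E) x) x)

/-- The exterior product of an alternating `1`-form with an alternating `p`-form:
`(a ∧ b)(v₀, …, vₚ) = ∑ i, (-1) ^ i * a(vᵢ) * b(v₀, …, v̂ᵢ, …, vₚ)`. -/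
def altWedge {p : ℕ} (a : E [⋀^Fin 1]→L[ℝ] ℝ) (b : E [⋀^Fin p]→L[ℝ] ℝ) :
    E [⋀^Fin (p + 1)]→L[ℝ] ℝ :=
  ContinuousAlternatingMap.alternatizeUncurryFin
    (((ContinuousAlternatingMap.ofSubsingleton ℝ E ℝ (0 : Fin 1)).symm a).smulRight b)

/-- The exterior product of a differential `1`-form with a differential `p`-form. -/
def wedge {p : ℕ} (τ : DForm E M 1) (θ : DForm E M p) : DForm E M (p + 1) := fun x =>
  altWedge (E := E) (τ x) (θ x)

/-- The Lichnerowicz differential `d_τ θ = dθ + τ ∧ θ`. -/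
def lichD {p : ℕ} (τ : DForm E M 1) (θ : DForm E M p) : DForm E M (p + 1) :=
  extD θ + wedge τ θ

theorem chartRep_add {p : ℕ} (θ₁ θ₂ : DForm E M p) (x : M) :
    chartRep (θ₁ + θ₂) x = chartRep θ₁ x + chartRep θ₂ x := rfl

theorem chartRep_smul {p : ℕ} (c : ℝ) (θ : DForm E M p) (x : M) :
    chartRep (c • θ) x = c • chartRep θ x := rfl

theorem IsSmoothForm.zero {p : ℕ} : IsSmoothForm (0 : DForm E M p) :=
  fun _ => contDiffOn_const (c := 0)

theorem IsSmoothForm.add {p : ℕ} {θ₁ θ₂ : DForm E M p} (h₁ : IsSmoothForm θ₁)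
    (h₂ : IsSmoothForm θ₂) : IsSmoothForm (θ₁ + θ₂) := fun x => (h₁ x).add (h₂ x)

theorem IsSmoothForm.smul {p : ℕ} (c : ℝ) {θ : DForm E M p} (h : IsSmoothForm θ) :
    IsSmoothForm (c • θ) := fun x => (h x).const_smul c

theorem IsSmoothForm.differentiableAt {p : ℕ} {θ : DForm E M p} (h : IsSmoothForm θ) (x : M) :
    DifferentiableAt ℝ (chartRep θ x) (extChartAt 𝓘(ℝ, E) x x) :=
  ((h x).contDiffAt ((isOpen_extChartAt_target (I := 𝓘(ℝ, E)) x).mem_nhds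
    (mem_extChartAt_target x))).differentiableAt (by simp)

theorem extD_add {p : ℕ} {θ₁ θ₂ : DForm E M p} (h₁ : IsSmoothForm θ₁)
    (h₂ : IsSmoothForm θ₂) : extD (θ₁ + θ₂) = extD θ₁ + extD θ₂ := by
  funext x
  simp only [extD, chartRep_add, extDeriv_add (h₁.differentiableAt x) (h₂.differentiableAt x)]
  rfl

theorem extD_smul {p : ℕ} (c : ℝ) (θ : DForm E M p) : extD (c • θ) = c • extD θ := by
  funext x
  simp only [extD, chartRep_smul, extDeriv_smul]
  rfl

theorem altWedge_add {p : ℕ} (a : E [⋀^Fin 1]→L[ℝ] ℝ) (b₁ b₂ : E [⋀^Fin p]→L[ℝ] ℝ) :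
    altWedge a (b₁ + b₂) = altWedge a b₁ + altWedge a b₂ := by
  ext v
  simp [altWedge, ContinuousAlternatingMap.alternatizeUncurryFin_apply,
    Finset.sum_add_distrib]

theorem altWedge_smul {p : ℕ} (a : E [⋀^Fin 1]→L[ℝ] ℝ) (c : ℝ) (b : E [⋀^Fin p]→L[ℝ] ℝ) :
    altWedge a (c • b) = c • altWedge a b := by
  ext v
  simp only [altWedge, ContinuousAlternatingMap.alternatizeUncurryFin_apply,
    ContinuousAlternatingMap.smul_apply, Finset.smul_sum, ContinuousLinearMap.smulRight_apply]
  refine Finset.sum_congr rfl fun i _ => ?_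
  simp only [smul_eq_mul, zsmul_eq_mul]
  ring

theorem wedge_add {p : ℕ} (τ : DForm E M 1) (θ₁ θ₂ : DForm E M p) :
    wedge τ (θ₁ + θ₂) = wedge τ θ₁ + wedge τ θ₂ :=
  funext fun x => altWedge_add (E := E) (τ x) (θ₁ x) (θ₂ x)

theorem wedge_smul {p : ℕ} (τ : DForm E M 1) (c : ℝ) (θ : DForm E M p) :
    wedge τ (c • θ) = c • wedge τ θ :=
  funext fun x => altWedge_smul (E := E) (τ x) c (θ x)

theorem lichD_add {p : ℕ} (τ : DForm E M 1) {θ₁ θ₂ : DForm E M p} (h₁ : IsSmoothForm θ₁)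
    (h₂ : IsSmoothForm θ₂) : lichD τ (θ₁ + θ₂) = lichD τ θ₁ + lichD τ θ₂ := by
  simp only [lichD, extD_add h₁ h₂, wedge_add]
  abel

theorem lichD_smul {p : ℕ} (τ : DForm E M 1) (c : ℝ) (θ : DForm E M p) :
    lichD τ (c • θ) = c • lichD τ θ := by
  simp only [lichD, extD_smul, wedge_smul, smul_add]

theorem lichD_zero {p : ℕ} (τ : DForm E M 1) : lichD τ (0 : DForm E M p) = 0 := by
  have := lichD_smul τ 0 (0 : DForm E M p)
  simpa using this

/-- The smooth `d_τ`-closed `p`-forms. -/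
def lichClosed (τ : DForm E M 1) (p : ℕ) : Submodule ℝ (DForm E M p) where
  carrier := {θ | IsSmoothForm θ ∧ lichD τ θ = 0}
  zero_mem' := ⟨IsSmoothForm.zero, lichD_zero τ⟩
  add_mem' h₁ h₂ := ⟨h₁.1.add h₂.1, by rw [lichD_add τ h₁.1 h₂.1, h₁.2, h₂.2, add_zero]⟩
  smul_mem' c _ h := ⟨h.1.smul c, by rw [lichD_smul, h.2, smul_zero]⟩

/-- The `d_τ`-exact `p`-forms: the image under `d_τ` of the smooth forms of degree `p - 1`. -/
def lichExact (τ : DForm E M 1) : (p : ℕ) → Submodule ℝ (DForm E M p)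
  | 0 => ⊥
  | p + 1 =>
    { carrier := {Ω | ∃ θ : DForm E M p, IsSmoothForm θ ∧ lichD τ θ = Ω}
      zero_mem' := ⟨0, IsSmoothForm.zero, lichD_zero τ⟩
      add_mem' := by
        rintro _ _ ⟨θ₁, h₁, rfl⟩ ⟨θ₂, h₂, rfl⟩
        exact ⟨θ₁ + θ₂, h₁.add h₂, lichD_add τ h₁ h₂⟩
      smul_mem' := by
        rintro c _ ⟨θ, h, rfl⟩
        exact ⟨c • θ, h.smul c, lichD_smul τ c θ⟩ }

/-- The Lichnerowicz cohomology `H^p_τ(M) = ker d_τ / im d_τ`. -/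
abbrev LichCohomology (τ : DForm E M 1) (p : ℕ) : Type _ :=
  lichClosed τ p ⧸ (lichExact τ p).submoduleOf (lichClosed τ p)

/-- The Lichnerowicz class of a smooth `d_τ`-closed form. -/
def lichClass (τ : DForm E M 1) {p : ℕ} (θ : DForm E M p) (h : θ ∈ lichClosed τ p) :
    LichCohomology τ p :=
  Submodule.Quotient.mk ⟨θ, h⟩

/-- A `2`-form is non-degenerate if at every point no nonzero tangent vector is orthogonal to all
tangent vectors. -/
def IsNondegenerate (Ω : DForm E M 2) : Prop :=
  ∀ (x : M) (v : TangentSpace 𝓘(ℝ, E) x),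
    (∀ w : TangentSpace 𝓘(ℝ, E) x, Ω x ![v, w] = 0) → v = 0

/-- `Ω` is a locally conformal symplectic form with Lee form `τ`: a smooth non-degenerate `2`-form
with `dΩ = -τ ∧ Ω`, where `τ` is a smooth closed `1`-form. -/
structure IsLCSWithLeeForm (Ω : DForm E M 2) (τ : DForm E M 1) : Prop where
  smooth : IsSmoothForm Ω
  nondegenerate : IsNondegenerate Ω
  smooth_lee : IsSmoothForm τ
  closed_lee : extD τ = 0
  extD_eq : extD Ω = -wedge τ Ω

end Forms

/-! ### The solvable group `G_k` and its compact quotients -/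

/-- The group `G_k`, in the coordinates `(x, y, z)` of its matrices (see `Solv.toMatrix`). -/
def Solv (_k : ℝ) : Type := EuclideanSpace ℝ (Fin 3)

namespace Solv

variable {k : ℝ}

instance : TopologicalSpace (Solv k) := inferInstanceAs (TopologicalSpace (EuclideanSpace ℝ (Fin 3)))
instance : T2Space (Solv k) := inferInstanceAs (T2Space (EuclideanSpace ℝ (Fin 3)))
instance : LocallyCompactSpace (Solv k) :=
  inferInstanceAs (LocallyCompactSpace (EuclideanSpace ℝ (Fin 3)))
instance : ChartedSpace (EuclideanSpace ℝ (Fin 3)) (Solv k) :=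
  inferInstanceAs (ChartedSpace (EuclideanSpace ℝ (Fin 3)) (EuclideanSpace ℝ (Fin 3)))

/-- The element of `G_k` with coordinates `x, y, z`. -/
def mk (x y z : ℝ) : Solv k := (!₂[x, y, z] : EuclideanSpace ℝ (Fin 3))

/-- The coordinate `x`. -/
def x (g : Solv k) : ℝ := (show EuclideanSpace ℝ (Fin 3) from g) 0
/-- The coordinate `y`. -/
def y (g : Solv k) : ℝ := (show EuclideanSpace ℝ (Fin 3) from g) 1
/-- The coordinate `z`. -/
def z (g : Solv k) : ℝ := (show EuclideanSpace ℝ (Fin 3) from g) 2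

/-- The matrix with coordinates `(x, y, z)`. -/
def toMatrix (g : Solv k) : Matrix (Fin 4) (Fin 4) ℝ :=
  !![Real.exp (k * g.z), 0, 0, g.x;
     0, Real.exp (-(k * g.z)), 0, g.y;
     0, 0, 1, g.z;
     0, 0, 0, 1]

@[simp] theorem x_mk (a b c : ℝ) : (mk a b c : Solv k).x = a := rfl
@[simp] theorem y_mk (a b c : ℝ) : (mk a b c : Solv k).y = b := rfl
@[simp] theorem z_mk (a b c : ℝ) : (mk a b c : Solv k).z = c := rfl

@[ext] theorem ext' {g h : Solv k} (hx : g.x = h.x) (hy : g.y = h.y) (hz : g.z = h.z) : g = h := by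
  apply PiLp.ext
  intro i
  fin_cases i
  exacts [hx, hy, hz]

/-- Multiplication and inversion of the matrices, in coordinates (see `Solv.toMatrix_mul`). -/
instance : Group (Solv k) where
  mul g h := mk (g.x + Real.exp (k * g.z) * h.x) (g.y + Real.exp (-(k * g.z)) * h.y) (g.z + h.z)
  one := mk 0 0 0
  inv g := mk (-(Real.exp (-(k * g.z)) * g.x)) (-(Real.exp (k * g.z) * g.y)) (-g.z)
  mul_assoc a b c := by
    change mk _ _ _ = mk _ _ _
    ext
    · change _ + Real.exp (k * (_ + _)) * _ = _ + _ * (_ + _)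
      rw [mul_add k, Real.exp_add]
      change _ + _ * _ + _ = _
      ring
    · change _ + Real.exp (-(k * (_ + _))) * _ = _ + _ * (_ + _)
      rw [mul_add k, neg_add, Real.exp_add]
      change _ + _ * _ + _ = _
      ring
    · exact add_assoc _ _ _
  one_mul a := by
    change mk _ _ _ = a
    ext
    · change 0 + Real.exp (k * 0) * a.x = a.x
      simp
    · change 0 + Real.exp (-(k * 0)) * a.y = a.y
      simp
    · exact zero_add _
  mul_one a := by
    change mk _ _ _ = a
    ext
    · change a.x + Real.exp (k * a.z) * 0 = a.x
      simp
    · change a.y + Real.exp (-(k * a.z)) * 0 = a.y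
      simp
    · exact add_zero _
  inv_mul_cancel a := by
    change mk _ _ _ = mk 0 0 0
    ext
    · change -(Real.exp (-(k * a.z)) * a.x) + Real.exp (k * -a.z) * a.x = 0
      rw [mul_neg]
      ring
    · change -(Real.exp (k * a.z) * a.y) + Real.exp (-(k * -a.z)) * a.y = 0
      rw [mul_neg, neg_neg]
      ring
    · exact neg_add_cancel a.z

theorem mul_def (g h : Solv k) : g * h =
    mk (g.x + Real.exp (k * g.z) * h.x) (g.y + Real.exp (-(k * g.z)) * h.y) (g.z + h.z) := rfl

theorem toMatrix_mul (g h : Solv k) : (g * h).toMatrix = g.toMatrix * h.toMatrix := by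
  have h₁ : Real.exp (k * (g.z + h.z)) = Real.exp (k * g.z) * Real.exp (k * h.z) := by
    rw [mul_add, Real.exp_add]
  have h₂ : Real.exp (-(k * (g.z + h.z))) = Real.exp (-(k * g.z)) * Real.exp (-(k * h.z)) := by
    rw [mul_add, neg_add, Real.exp_add]
  ext i j
  fin_cases i <;> fin_cases j <;>
    simp [toMatrix, mul_def, Matrix.mul_apply, Fin.sum_univ_four, h₁, h₂, add_comm]

theorem toMatrix_injective : Function.Injective (toMatrix : Solv k → Matrix (Fin 4) (Fin 4) ℝ) := by
  intro g h hgh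
  ext
  · exact congrFun (congrFun hgh 0) 3
  · exact congrFun (congrFun hgh 1) 3
  · exact congrFun (congrFun hgh 2) 3

theorem continuous_x : Continuous (x : Solv k → ℝ) :=
  (EuclideanSpace.proj (𝕜 := ℝ) (0 : Fin 3)).continuous

theorem continuous_y : Continuous (y : Solv k → ℝ) :=
  (EuclideanSpace.proj (𝕜 := ℝ) (1 : Fin 3)).continuous

theorem continuous_z : Continuous (z : Solv k → ℝ) :=
  (EuclideanSpace.proj (𝕜 := ℝ) (2 : Fin 3)).continuous

theorem continuous_mk {X : Type*} [TopologicalSpace X] {a b c : X → ℝ} (ha : Continuous a)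
    (hb : Continuous b) (hc : Continuous c) : Continuous fun t => (mk (a t) (b t) (c t) : Solv k) := by
  refine (PiLp.continuous_toLp 2 fun _ : Fin 3 => ℝ).comp (continuous_pi fun i => ?_)
  fin_cases i
  exacts [ha, hb, hc]

instance : IsTopologicalGroup (Solv k) where
  continuous_mul := by
    have h₁ := continuous_x (k := k)
    have h₂ := continuous_y (k := k)
    have h₃ := continuous_z (k := k)
    exact continuous_mk (by fun_prop) (by fun_prop) (by fun_prop)
  continuous_inv := by
    have h₁ := continuous_x (k := k)
    have h₂ := continuous_y (k := k)
    have h₃ := continuous_z (k := k)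
    exact continuous_mk (by fun_prop) (by fun_prop) (by fun_prop)

/-- The differentials `dx`, `dy`, `dz` of the coordinates, for `i = 0, 1, 2`. -/
def dcoord (i : Fin 3) : DForm (EuclideanSpace ℝ (Fin 3)) (Solv k) 1 := fun _ =>
  ContinuousAlternatingMap.ofSubsingleton ℝ (EuclideanSpace ℝ (Fin 3)) ℝ (0 : Fin 1)
    (EuclideanSpace.proj i)

/-- The right invariant form `dx - k x dz`. -/
def alpha : DForm (EuclideanSpace ℝ (Fin 3)) (Solv k) 1 := fun g =>
  dcoord 0 g - (k * g.x) • dcoord 2 g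

/-- The right invariant form `dy + k y dz`. -/
def beta : DForm (EuclideanSpace ℝ (Fin 3)) (Solv k) 1 := fun g =>
  dcoord 1 g + (k * g.y) • dcoord 2 g

/-- The right invariant form `dz`. -/
def gamma : DForm (EuclideanSpace ℝ (Fin 3)) (Solv k) 1 := dcoord 2

end Solv

section Quotient

variable {k : ℝ} (Γ : Subgroup (Solv k)) [DiscreteTopology Γ]

instance : ProperlyDiscontinuousSMul Γ.op (Solv k) :=
  Subgroup.properlyDiscontinuousSMul_opposite_of_tendsto_cofinite Γ
    (Subgroup.tendsto_coe_cofinite_of_discrete Γ ⟨inferInstance⟩)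

instance : IsCancelSMul Γ.op (Solv k) where
  left_cancel' _ _ _ h := mul_right_cancel h
  right_cancel' _ _ _ h := Subtype.ext (MulOpposite.unop_injective (mul_left_cancel h))

/-- The smooth structure of `N_k = G_k / Γ`: the charts are those of `G_k` composed with local
inverses of the covering map `G_k → G_k / Γ`. -/
instance : ChartedSpace (EuclideanSpace ℝ (Fin 3)) (Solv k ⧸ Γ) :=
  inferInstanceAs (ChartedSpace (EuclideanSpace ℝ (Fin 3))
    (MulAction.orbitRel.Quotient Γ.op (Solv k)))

/-- The form on `G_k / Γ` induced by a right invariant form on `G_k`. Its value at a coset is read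
off at a representative `g`, through the inverse of the derivative at `g` of the projection; right
invariance makes the choice of `g` irrelevant. -/
def descend {p : ℕ} (θ : DForm (EuclideanSpace ℝ (Fin 3)) (Solv k) p) :
    DForm (EuclideanSpace ℝ (Fin 3)) (Solv k ⧸ Γ) p := fun c =>
  (θ c.out).compContinuousLinearMap
    (mfderiv (𝓡 3) (𝓡 3) (QuotientGroup.mk : Solv k → Solv k ⧸ Γ) c.out).inverse

end Quotient

/-! ### Principal circle bundles and connections -/

section Bundle

variable {M : Type*} [TopologicalSpace M] [ChartedSpace (EuclideanSpace ℝ (Fin 4)) M]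
  [MulAction Circle M]
  {N : Type*} [TopologicalSpace N] [ChartedSpace (EuclideanSpace ℝ (Fin 3)) N]

/-- `π : M → N` is a smooth principal circle bundle, `N` of dimension `3` and `M` of dimension
`4`. -/
structure IsPrincipalCircleBundle (π : M → N) : Prop where
  contMDiff_smul : ContMDiff ((𝓡 1).prod (𝓡 4)) (𝓡 4) ∞ (fun q : Circle × M => q.1 • q.2)
  contMDiff_proj : ContMDiff (𝓡 4) (𝓡 3) ∞ π
  proj_smul : ∀ (g : Circle) (m : M), π (g • m) = π m
  locally_trivial : ∀ b : N, ∃ U : Set N, IsOpen U ∧ b ∈ U ∧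
    ∃ e : OpenPartialHomeomorph M (N × Circle), e.source = π ⁻¹' U ∧ e.target = U ×ˢ univ ∧
      ContMDiffOn (𝓡 4) ((𝓡 3).prod (𝓡 1)) ∞ e e.source ∧
      ContMDiffOn ((𝓡 3).prod (𝓡 1)) (𝓡 4) ∞ e.symm e.target ∧
      (∀ m ∈ e.source, (e m).1 = π m) ∧
      (∀ m ∈ e.source, ∀ g : Circle, (e (g • m)).2 = g * (e m).2)

/-- The fundamental vector field of the circle action, where the circle is parametrized as
`ℝ / ℤ`: the velocity at time `0` of `t ↦ exp(2πit) • m`. -/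
def fundamentalField (m : M) : TangentSpace (𝓡 4) m :=
  (mfderiv 𝓘(ℝ, ℝ) (𝓡 4) (fun t : ℝ => Circle.exp (2 * Real.pi * t) • m) 0 (1 : ℝ) :
    EuclideanSpace ℝ (Fin 4))

/-- A connection form: a smooth `1`-form, invariant under the circle, equal to `1` on the
fundamental vector field. With this normalization the curvature `dη` of a connection is the
pullback of a closed form on the base that represents the real Chern class of the bundle. -/
structure IsConnectionForm (η : DForm (EuclideanSpace ℝ (Fin 4)) M 1) : Prop where
  smooth : IsSmoothForm η
  invariant : ∀ g : Circle, pullback (fun m : M => g • m) η = η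
  apply_fundamentalField : ∀ m : M, η m ![fundamentalField m] = 1

end Bundle

end ACFM

end

/-! On `G_k` the right invariant coframe satisfies dα = -k α∧γ, dβ = k β∧γ, dγ = 0. These equations
descend to N_k and pull back to M, where dη = nλ α∧β joins them. With the Leibniz rule, dΩ = kγ∧Ω
becomes an identity in the four forms; for instance nλ α∧β - k γ∧η is d_ω η for ω = -kγ. At each
point α, β, γ, η form a basis of the cotangent space (`exists_coframe_eq`), and Ω∧Ω = 2(t₁t₂ - nkλ
t₃²) α∧β∧γ∧η, which explains the condition on the parameters. Both facts are proved in
`isLCSWithLeeForm_of_structure_equations`, by evaluating on vectors.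

The class is nonzero because exactness would force t₁ = 0. Suppose Ω = d_ω θ, let X be the
fundamental field and u a lift of ∂/∂x. Since γ vanishes on u and on X, the Lee term disappears and
dθ(u, X) = Ω(u, X) = t₁. Integrating θ over the fibres gives a function f on N_k. Green's theorem on
the cylinder of fibres over a segment in the direction ∂/∂x shows that f grows at the constant rate
t₁ along the image of the x-axis of `G_k`. But f is continuous on a compact space, hence bounded, so
t₁ = 0. This is `IsPrincipalCircleBundle.eq_zero_of_extD_eq`, applied in `lcsForm_notMem_lichExact`.

The second family is the first one after exchanging α with β and changing the signs of k and of nλ;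
the direction ∂/∂y then replaces ∂/∂x.

The supporting calculus is naturality of d (`extD_pullback`), the Leibniz rule (`extD_wedge_apply`),
and the fact that in every chart of N_k a descended form has the same coordinate expression as on
`G_k` (`chartRep_descend`). -/

noncomputable section

namespace ACFM

/-! ### Pullbacks of forms and naturality of the exterior derivative -/

section Pullback

variable {E : Type*} [NormedAddCommGroup E] [NormedSpace ℝ E]
  {M : Type*} [TopologicalSpace M] [ChartedSpace E M]
  {F : Type*} [NormedAddCommGroup F] [NormedSpace ℝ F]
  {N : Type*} [TopologicalSpace N] [ChartedSpace F N]
  {F' : Type*} [NormedAddCommGroup F'] [NormedSpace ℝ F']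
  {N' : Type*} [TopologicalSpace N'] [ChartedSpace F' N']

theorem pullback_apply {p : ℕ} (f : M → N) (θ : DForm F N p) (x : M)
    (v : Fin p → TangentSpace 𝓘(ℝ, E) x) :
    pullback f θ x v = θ (f x) (fun i => mfderiv 𝓘(ℝ, E) 𝓘(ℝ, F) f x (v i)) := rfl

theorem pullback_comp {p : ℕ} {g : N → N'} {f : M → N} (θ : DForm F' N' p) {x : M}
    (hg : MDifferentiableAt 𝓘(ℝ, F) 𝓘(ℝ, F') g (f x))
    (hf : MDifferentiableAt 𝓘(ℝ, E) 𝓘(ℝ, F) f x) :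
    (pullback (g ∘ f) θ : DForm E M p) x = pullback f (pullback g θ : DForm F N p) x := by
  ext v
  rw [pullback_apply, mfderiv_comp x hg hf]
  rfl

theorem pullback_congr {p : ℕ} {f g : M → N} (θ : DForm F N p) {x : M} (h : f =ᶠ[𝓝 x] g) :
    (pullback f θ : DForm E M p) x = pullback g θ x := by
  have h₁ : f x = g x := h.self_of_nhds
  -- The tangent spaces at `f x` and `g x` are formally different types, so the equalities are
  -- stated over the model spaces to which they unfold.
  have h₂ : (mfderiv 𝓘(ℝ, E) 𝓘(ℝ, F) f x : E →L[ℝ] F) = mfderiv 𝓘(ℝ, E) 𝓘(ℝ, F) g x :=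
    h.mfderiv_eq
  have h₃ : @Eq (F [⋀^Fin p]→L[ℝ] ℝ) (θ (f x)) (θ (g x)) := by rw [h₁]
  exact congrArg₂ (fun (a : F [⋀^Fin p]→L[ℝ] ℝ) (b : E →L[ℝ] F) =>
    a.compContinuousLinearMap b) h₃ h₂

/-- On a vector space the pullback is expressed through the Fréchet derivative. -/
theorem pullback_vectorSpace {p : ℕ} (f : E → F) (θ : F → F [⋀^Fin p]→L[ℝ] ℝ) (x : E) :
    (pullback f (θ : DForm F F p) : DForm E E p) x =
      (θ (f x)).compContinuousLinearMap (fderiv ℝ f x) := by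
  unfold pullback
  rw [mfderiv_eq_fderiv]
  rfl

variable [IsManifold 𝓘(ℝ, E) ∞ M] [IsManifold 𝓘(ℝ, F) ∞ N]

theorem mdifferentiableAt_extChartAt_symm' {x : M} {y : E}
    (hy : y ∈ (extChartAt 𝓘(ℝ, E) x).target) :
    MDifferentiableAt 𝓘(ℝ, E) 𝓘(ℝ, E) (extChartAt 𝓘(ℝ, E) x).symm y :=
  ((contMDiffOn_extChartAt_symm (n := ∞) x).contMDiffAt
    ((isOpen_extChartAt_target x).mem_nhds hy)).mdifferentiableAt (by simp)

/-- The expression of a form at the point of a chart recovers the form. -/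
theorem pullback_extChartAt_chartRep {p : ℕ} (θ : DForm F N p) {c : N} {z : N}
    (hz : z ∈ (extChartAt 𝓘(ℝ, F) c).source) :
    pullback (extChartAt 𝓘(ℝ, F) c) (chartRep θ c : DForm F F p) z = θ z := by
  have h₁ := mdifferentiableAt_extChartAt_symm' (((extChartAt 𝓘(ℝ, F) c).map_source hz))
  have h₂ : MDifferentiableAt 𝓘(ℝ, F) 𝓘(ℝ, F) (extChartAt 𝓘(ℝ, F) c) z :=
    (contMDiffAt_extChartAt' (n := ∞) (by simpa using hz)).mdifferentiableAt (by simp)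
  have := pullback_comp θ h₁ h₂
  change _ = pullback _ (chartRep θ c : DForm F F p) z at this
  rw [← this, pullback_congr (g := id) θ]
  · ext v
    rw [pullback_apply]
    simp [mfderiv_id]
  · filter_upwards [(isOpen_extChartAt_source (I := 𝓘(ℝ, F)) c).mem_nhds hz] with w hw
    exact (extChartAt 𝓘(ℝ, F) c).left_inv hw

/-- The expression of a pulled back form in charts. -/
theorem chartRep_pullback_apply {p : ℕ} {f : M → N} (θ : DForm F N p) {x : M} {c : N} {y : E}
    (hy : y ∈ (extChartAt 𝓘(ℝ, E) x).target)
    (hf : MDifferentiableAt 𝓘(ℝ, E) 𝓘(ℝ, F) f ((extChartAt 𝓘(ℝ, E) x).symm y))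
    (hc : f ((extChartAt 𝓘(ℝ, E) x).symm y) ∈ (extChartAt 𝓘(ℝ, F) c).source) :
    chartRep (pullback f θ) x y =
      (chartRep θ c
        ((extChartAt 𝓘(ℝ, F) c ∘ f ∘ (extChartAt 𝓘(ℝ, E) x).symm) y)).compContinuousLinearMap
        (fderiv ℝ (extChartAt 𝓘(ℝ, F) c ∘ f ∘ (extChartAt 𝓘(ℝ, E) x).symm) y) := by
  have h₁ := mdifferentiableAt_extChartAt_symm' hy
  have h₂ : MDifferentiableAt 𝓘(ℝ, F) 𝓘(ℝ, F) (extChartAt 𝓘(ℝ, F) c)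
      ((f ∘ (extChartAt 𝓘(ℝ, E) x).symm) y) :=
    (contMDiffAt_extChartAt' (n := ∞) (by simpa using hc)).mdifferentiableAt (by simp)
  have h₃ := pullback_comp (p := p) (chartRep θ c : DForm F F p) h₂ (hf.comp y h₁)
  refine Eq.trans ?_ (h₃.symm.trans (pullback_vectorSpace _ _ _))
  have h₄ : pullback (E := E) (M := E) (f ∘ (extChartAt 𝓘(ℝ, E) x).symm) θ y =
    pullback (extChartAt 𝓘(ℝ, E) x).symm (pullback f θ : DForm E M p) y := pullback_comp θ hf h₁
  refine h₄.symm.trans ?_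
  ext v
  rw [pullback_apply, pullback_apply]
  rw [pullback_extChartAt_chartRep (z := (f ∘ (extChartAt 𝓘(ℝ, E) x).symm) y) θ hc]

/-- The exterior derivative depends on the germ of the chart expression, so the pointwise formula is
needed on a neighbourhood. -/
theorem eventually_chartRep_pullback {p : ℕ} {f : M → N} (θ : DForm F N p) {x : M} {y : E}
    (hy : y ∈ (extChartAt 𝓘(ℝ, E) x).target)
    (hf : ContMDiffAt 𝓘(ℝ, E) 𝓘(ℝ, F) ∞ f ((extChartAt 𝓘(ℝ, E) x).symm y))
    {c : N} (hc : f ((extChartAt 𝓘(ℝ, E) x).symm y) ∈ (extChartAt 𝓘(ℝ, F) c).source) :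
    chartRep (pullback f θ) x =ᶠ[𝓝 y] fun y' =>
      (chartRep θ c
        ((extChartAt 𝓘(ℝ, F) c ∘ f ∘ (extChartAt 𝓘(ℝ, E) x).symm) y')).compContinuousLinearMap
        (fderiv ℝ (extChartAt 𝓘(ℝ, F) c ∘ f ∘ (extChartAt 𝓘(ℝ, E) x).symm) y') := by
  have hs : ContinuousAt (extChartAt 𝓘(ℝ, E) x).symm y :=
    (mdifferentiableAt_extChartAt_symm' hy).continuousAt
  have h₁ : ∀ᶠ z in 𝓝 ((extChartAt 𝓘(ℝ, E) x).symm y), MDifferentiableAt 𝓘(ℝ, E) 𝓘(ℝ, F) f z :=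
    ((contMDiffAt_iff_contMDiffAt_nhds (by simp)).1 (hf.of_le (m := 1) (by simp))).mono fun z hz =>
      hz.mdifferentiableAt (by simp)
  have h₂ : ∀ᶠ z in 𝓝 ((extChartAt 𝓘(ℝ, E) x).symm y), f z ∈ (extChartAt 𝓘(ℝ, F) c).source :=
    hf.continuousAt.eventually_mem ((isOpen_extChartAt_source (I := 𝓘(ℝ, F)) c).mem_nhds hc)
  filter_upwards [(isOpen_extChartAt_target (I := 𝓘(ℝ, E)) x).mem_nhds hy, hs.eventually h₁,
    hs.eventually h₂] with z hz₁ hz₂ hz₃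
  exact chartRep_pullback_apply θ hz₁ hz₂ hz₃

theorem contDiffAt_chart_comp {f : M → N} {x : M} {y : E}
    (hy : y ∈ (extChartAt 𝓘(ℝ, E) x).target)
    (hf : ContMDiffAt 𝓘(ℝ, E) 𝓘(ℝ, F) ∞ f ((extChartAt 𝓘(ℝ, E) x).symm y))
    {c : N} (hc : f ((extChartAt 𝓘(ℝ, E) x).symm y) ∈ (extChartAt 𝓘(ℝ, F) c).source) :
    ContDiffAt ℝ ∞ (extChartAt 𝓘(ℝ, F) c ∘ f ∘ (extChartAt 𝓘(ℝ, E) x).symm) y := by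
  rw [← contMDiffAt_iff_contDiffAt]
  have h₁ : ContMDiffAt 𝓘(ℝ, E) 𝓘(ℝ, E) ∞ (extChartAt 𝓘(ℝ, E) x).symm y :=
    (contMDiffOn_extChartAt_symm (n := ∞) x).contMDiffAt
      ((isOpen_extChartAt_target x).mem_nhds hy)
  have h₂ : ContMDiffAt 𝓘(ℝ, F) 𝓘(ℝ, F) ∞ (extChartAt 𝓘(ℝ, F) c)
      (f ((extChartAt 𝓘(ℝ, E) x).symm y)) :=
    contMDiffAt_extChartAt' (n := ∞) (by simpa using hc)
  exact h₂.comp y (hf.comp y h₁)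

/-- The exterior derivative commutes with the pullback. -/
theorem extD_pullback {p : ℕ} {f : M → N} {θ : DForm F N p} (hθ : IsSmoothForm θ) {x : M}
    (hf : ContMDiffAt 𝓘(ℝ, E) 𝓘(ℝ, F) ∞ f x) :
    extD (pullback f θ : DForm E M p) x = pullback f (extD θ) x := by
  have hx : (extChartAt 𝓘(ℝ, E) x).symm (extChartAt 𝓘(ℝ, E) x x) = x := extChartAt_to_inv x
  have hy := mem_extChartAt_target (I := 𝓘(ℝ, E)) x
  have hf' : ContMDiffAt 𝓘(ℝ, E) 𝓘(ℝ, F) ∞ f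
      ((extChartAt 𝓘(ℝ, E) x).symm (extChartAt 𝓘(ℝ, E) x x)) := by rwa [hx]
  have hc : f ((extChartAt 𝓘(ℝ, E) x).symm (extChartAt 𝓘(ℝ, E) x x)) ∈
      (extChartAt 𝓘(ℝ, F) (f x)).source := by rw [hx]; exact mem_extChartAt_source (f x)
  have hF := contDiffAt_chart_comp hy hf' hc
  have hval : (extChartAt 𝓘(ℝ, F) (f x) ∘ f ∘ (extChartAt 𝓘(ℝ, E) x).symm)
      (extChartAt 𝓘(ℝ, E) x x) = extChartAt 𝓘(ℝ, F) (f x) (f x) := by simp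
  unfold extD
  rw [(eventually_chartRep_pullback θ hy hf' hc).extDeriv_eq,
    extDeriv_pullback (by rw [hval]; exact hθ.differentiableAt (f x)) hF
      (by simpa using WithTop.coe_le_coe.2 (le_top (a := (2 : ℕ∞))))]
  have hd : MDifferentiableAt 𝓘(ℝ, E) 𝓘(ℝ, E) (extChartAt 𝓘(ℝ, E) x) x :=
    mdifferentiableAt_extChartAt (mem_chart_source E x)
  have hd' : MDifferentiableAt 𝓘(ℝ, F) 𝓘(ℝ, F) (extChartAt 𝓘(ℝ, F) (f x)) (f x) :=
    mdifferentiableAt_extChartAt (mem_chart_source F (f x))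
  -- The chain rule absorbs the chart derivatives hidden in `extD` on both sides, leaving the
  -- derivative of `f` alone.
  have hchain : ∀ v : E, fderiv ℝ (extChartAt 𝓘(ℝ, F) (f x) ∘ f ∘ (extChartAt 𝓘(ℝ, E) x).symm)
      (extChartAt 𝓘(ℝ, E) x x) (mfderiv 𝓘(ℝ, E) 𝓘(ℝ, E) (extChartAt 𝓘(ℝ, E) x) x v) =
      mfderiv 𝓘(ℝ, F) 𝓘(ℝ, F) (extChartAt 𝓘(ℝ, F) (f x)) (f x)
        (mfderiv 𝓘(ℝ, E) 𝓘(ℝ, F) f x v) := by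
    intro v
    have e₁ := mfderiv_comp (I'' := 𝓘(ℝ, F)) x (hF.differentiableAt (by simp)).mdifferentiableAt hd
    have e₂ := mfderiv_comp x hd' (hf.mdifferentiableAt (by simp))
    have e₃ : (extChartAt 𝓘(ℝ, F) (f x) ∘ f ∘ (extChartAt 𝓘(ℝ, E) x).symm) ∘
        (extChartAt 𝓘(ℝ, E) x) =ᶠ[𝓝 x] extChartAt 𝓘(ℝ, F) (f x) ∘ f := by
      filter_upwards [extChartAt_source_mem_nhds (I := 𝓘(ℝ, E)) x] with z hz
      simp only [Function.comp_apply, (extChartAt 𝓘(ℝ, E) x).left_inv hz]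
    have e₄ : (mfderiv 𝓘(ℝ, E) 𝓘(ℝ, F) ((extChartAt 𝓘(ℝ, F) (f x) ∘ f ∘
      (extChartAt 𝓘(ℝ, E) x).symm) ∘ (extChartAt 𝓘(ℝ, E) x)) x : E →L[ℝ] F) =
        mfderiv 𝓘(ℝ, E) 𝓘(ℝ, F) (extChartAt 𝓘(ℝ, F) (f x) ∘ f) x := e₃.mfderiv_eq
    rw [mfderiv_eq_fderiv] at e₁
    have := congrArg (fun l : E →L[ℝ] F => l v) (e₁.symm.trans (e₄.trans e₂))
    exact this
  ext v
  rw [hval]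
  exact congrArg (extDeriv (chartRep θ (f x)) (extChartAt 𝓘(ℝ, F) (f x) (f x)))
    (funext fun i => hchain (v i))

end Pullback

/-! ### Wedge products and the Leibniz rule on a vector space -/

section Wedge

variable {E : Type*} [NormedAddCommGroup E] [NormedSpace ℝ E]
  {M : Type*} [TopologicalSpace M] [ChartedSpace E M]
  {F : Type*} [NormedAddCommGroup F] [NormedSpace ℝ F]
  {N : Type*} [TopologicalSpace N] [ChartedSpace F N]

theorem altWedge_apply {p : ℕ} (a : E [⋀^Fin 1]→L[ℝ] ℝ) (b : E [⋀^Fin p]→L[ℝ] ℝ)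
    (v : Fin (p + 1) → E) :
    altWedge a b v = ∑ i : Fin (p + 1), (-1) ^ i.val * (a ![v i] * b (i.removeNth v)) := by
  rw [altWedge, ContinuousAlternatingMap.alternatizeUncurryFin_apply]
  refine Finset.sum_congr rfl fun i _ => ?_
  have : ((ContinuousAlternatingMap.ofSubsingleton ℝ E ℝ (0 : Fin 1)).symm a) (v i) = a ![v i] := by
    have h : (![v i] : Fin 1 → E) = fun _ => v i := by
      ext j
      fin_cases j
      rfl
    rw [h]
    rfl
  simp [this]

theorem altWedge_apply_two (a b : E [⋀^Fin 1]→L[ℝ] ℝ) (u v : E) :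
    altWedge a b ![u, v] = a ![u] * b ![v] - a ![v] * b ![u] := by
  have h₀ : (0 : Fin 2).removeNth ![u, v] = ![v] := by ext j; fin_cases j; rfl
  have h₁ : (1 : Fin 2).removeNth ![u, v] = ![u] := by ext j; fin_cases j; rfl
  rw [altWedge_apply, Fin.sum_univ_two, h₀, h₁]
  simp
  ring

theorem altWedge_apply_three (a : E [⋀^Fin 1]→L[ℝ] ℝ) (b : E [⋀^Fin 2]→L[ℝ] ℝ) (u v w : E) :
    altWedge a b ![u, v, w] = a ![u] * b ![v, w] - a ![v] * b ![u, w] + a ![w] * b ![u, v] := by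
  have h₀ : (0 : Fin 3).removeNth ![u, v, w] = ![v, w] := by ext j; fin_cases j <;> rfl
  have h₁ : (1 : Fin 3).removeNth ![u, v, w] = ![u, w] := by ext j; fin_cases j <;> rfl
  have h₂ : (2 : Fin 3).removeNth ![u, v, w] = ![u, v] := by ext j; fin_cases j <;> rfl
  rw [altWedge_apply, Fin.sum_univ_three, h₀, h₁, h₂]
  simp
  ring

theorem wedge_apply_two (τ θ : DForm E M 1) (x : M) (u v : TangentSpace 𝓘(ℝ, E) x) :
    wedge τ θ x ![u, v] = τ x ![u] * θ x ![v] - τ x ![v] * θ x ![u] :=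
  altWedge_apply_two (E := E) (τ x) (θ x) u v

theorem wedge_apply_three (τ : DForm E M 1) (θ : DForm E M 2) (x : M)
    (u v w : TangentSpace 𝓘(ℝ, E) x) :
    wedge τ θ x ![u, v, w] =
      τ x ![u] * θ x ![v, w] - τ x ![v] * θ x ![u, w] + τ x ![w] * θ x ![u, v] :=
  altWedge_apply_three (E := E) (τ x) (θ x) u v w

theorem compContinuousLinearMap_altWedge {p : ℕ} (a : F [⋀^Fin 1]→L[ℝ] ℝ)
    (b : F [⋀^Fin p]→L[ℝ] ℝ) (L : E →L[ℝ] F) :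
    (altWedge a b).compContinuousLinearMap L =
      altWedge (a.compContinuousLinearMap L) (b.compContinuousLinearMap L) := by
  ext v
  rw [ContinuousAlternatingMap.compContinuousLinearMap_apply, altWedge_apply, altWedge_apply]
  refine Finset.sum_congr rfl fun i _ => ?_
  have h : L ∘ ![v i] = ![L (v i)] := by
    ext j
    fin_cases j
    rfl
  rw [ContinuousAlternatingMap.compContinuousLinearMap_apply,
    ContinuousAlternatingMap.compContinuousLinearMap_apply, h]
  rfl

theorem pullback_wedge {p : ℕ} (f : M → N) (τ : DForm F N 1) (θ : DForm F N p) :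
    (pullback f (wedge τ θ) : DForm E M (p + 1)) = wedge (pullback f τ) (pullback f θ) :=
  funext fun x => compContinuousLinearMap_altWedge (E := E) (F := F) (τ (f x)) (θ (f x)) _

theorem chartRep_wedge {p : ℕ} (τ : DForm E M 1) (θ : DForm E M p) (x : M) (y : E) :
    chartRep (wedge τ θ) x y = altWedge (chartRep τ x y) (chartRep θ x y) :=
  congrFun (pullback_wedge (E := E) (M := E) (extChartAt 𝓘(ℝ, E) x).symm τ θ) y

theorem ContDiffAt.altWedge {p : ℕ} {G : Type*} [NormedAddCommGroup G] [NormedSpace ℝ G]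
    {n : WithTop ℕ∞} {x : G} {a : G → E [⋀^Fin 1]→L[ℝ] ℝ} {b : G → E [⋀^Fin p]→L[ℝ] ℝ}
    (ha : ContDiffAt ℝ n a x) (hb : ContDiffAt ℝ n b x) :
    ContDiffAt ℝ n (fun y => ACFM.altWedge (a y) (b y)) x := by
  have h : ContDiffAt ℝ n
      (fun y => ((ContinuousAlternatingMap.ofSubsingletonLIE (𝕜 := ℝ) (E := E) (F := ℝ)
        (0 : Fin 1)).symm (a y)).smulRight
        (b y)) x :=
    ((ContinuousAlternatingMap.ofSubsingletonLIE (𝕜 := ℝ) (E := E) (F := ℝ)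
        (0 : Fin 1)).symm.contDiff.contDiffAt.comp x
      ha).smulRight hb
  exact (ContinuousAlternatingMap.alternatizeUncurryFinCLM ℝ E ℝ).contDiff.contDiffAt.comp x h

theorem isSmoothForm_iff_contDiffAt {p : ℕ} {θ : DForm E M p} :
    IsSmoothForm θ ↔ ∀ x, ∀ y ∈ (extChartAt 𝓘(ℝ, E) x).target, ContDiffAt ℝ ∞ (chartRep θ x) y :=
  forall_congr' fun x => (isOpen_extChartAt_target (I := 𝓘(ℝ, E)) x).contDiffOn_iff.trans
    (by simp only)

theorem IsSmoothForm.wedge {p : ℕ} {τ : DForm E M 1} {θ : DForm E M p} (hτ : IsSmoothForm τ)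
    (hθ : IsSmoothForm θ) : IsSmoothForm (wedge τ θ) := by
  rw [isSmoothForm_iff_contDiffAt] at *
  intro x y hy
  simp only [show chartRep (ACFM.wedge τ θ) x = fun y => altWedge (chartRep τ x y) (chartRep θ x y)
    from funext (chartRep_wedge τ θ x)]
  exact ContDiffAt.altWedge (hτ x y hy) (hθ x y hy)

/-- In degree one, precomposition with `L` is composition of continuous linear maps, which is
bilinear and hence smooth in both arguments. This is all that pulling back the coframe requires;
forms of degree two are then built as wedges. -/
theorem contDiffAt_compContinuousLinearMap_one {G : Type*} [NormedAddCommGroup G] [NormedSpace ℝ G]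
    {n : WithTop ℕ∞} {x : G} {a : G → F [⋀^Fin 1]→L[ℝ] ℝ} {L : G → E →L[ℝ] F}
    (ha : ContDiffAt ℝ n a x) (hL : ContDiffAt ℝ n L x) :
    ContDiffAt ℝ n (fun y => (a y).compContinuousLinearMap (L y)) x := by
  have h : ContDiffAt ℝ n (fun y =>
      ((ContinuousAlternatingMap.ofSubsingletonLIE (𝕜 := ℝ) (E := F) (F := ℝ)
        (0 : Fin 1)).symm (a y)) ∘L (L y)) x :=
    ((ContinuousAlternatingMap.ofSubsingletonLIE (𝕜 := ℝ) (E := F) (F := ℝ)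
        (0 : Fin 1)).symm.contDiff.contDiffAt.comp x
      ha).clm_comp hL
  refine ((ContinuousAlternatingMap.ofSubsingletonLIE (𝕜 := ℝ) (E := E) (F := ℝ)
        (0 : Fin 1)).contDiff.contDiffAt.comp x h).congr_of_eventuallyEq (.of_forall fun y => ?_)
  ext v
  rw [ContinuousAlternatingMap.compContinuousLinearMap_apply]
  change a y _ = a y _
  congr 1
  ext j
  fin_cases j
  rfl

/-- The exterior derivative of a `1`-form on a vector space. -/
theorem extDeriv_apply_two (a : E → E [⋀^Fin 1]→L[ℝ] ℝ)
    (x u v : E) : extDeriv a x ![u, v] = fderiv ℝ a x u ![v] - fderiv ℝ a x v ![u] := by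
  have h₀ : (0 : Fin 2).removeNth ![u, v] = ![v] := by ext j; fin_cases j; rfl
  have h₁ : (1 : Fin 2).removeNth ![u, v] = ![u] := by ext j; fin_cases j; rfl
  rw [extDeriv, ContinuousAlternatingMap.alternatizeUncurryFin_apply, Fin.sum_univ_two, h₀, h₁]
  simp
  ring

theorem extDeriv_apply_three (a : E → E [⋀^Fin 2]→L[ℝ] ℝ) (x u v w : E) :
    extDeriv a x ![u, v, w] =
      fderiv ℝ a x u ![v, w] - fderiv ℝ a x v ![u, w] + fderiv ℝ a x w ![u, v] := by
  have h₀ : (0 : Fin 3).removeNth ![u, v, w] = ![v, w] := by ext j; fin_cases j <;> rfl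
  have h₁ : (1 : Fin 3).removeNth ![u, v, w] = ![u, w] := by ext j; fin_cases j <;> rfl
  have h₂ : (2 : Fin 3).removeNth ![u, v, w] = ![u, v] := by ext j; fin_cases j <;> rfl
  rw [extDeriv, ContinuousAlternatingMap.alternatizeUncurryFin_apply, Fin.sum_univ_three, h₀, h₁,
    h₂]
  simp
  ring

/-- Evaluation on fixed vectors is continuous and linear, so it commutes with differentiation; what
remains is the product rule for real functions. -/
theorem fderiv_altWedge_apply {a b : E → E [⋀^Fin 1]→L[ℝ] ℝ} {x : E}
    (ha : ContDiffAt ℝ 1 a x) (hb : ContDiffAt ℝ 1 b x) (u v w : E) :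
    fderiv ℝ (fun y => altWedge (a y) (b y)) x u ![v, w] =
      fderiv ℝ a x u ![v] * b x ![w] + a x ![v] * fderiv ℝ b x u ![w]
        - (fderiv ℝ a x u ![w] * b x ![v] + a x ![w] * fderiv ℝ b x u ![v]) := by
  have hab := (ContDiffAt.altWedge ha hb).differentiableAt (by simp)
  have da := ha.differentiableAt (by simp)
  have db := hb.differentiableAt (by simp)
  have ev : ∀ {m : ℕ} {c : E → E [⋀^Fin m]→L[ℝ] ℝ} (_ : DifferentiableAt ℝ c x) (z : Fin m → E),
      HasFDerivAt (fun y => c y z)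
        ((ContinuousAlternatingMap.apply ℝ E ℝ z).comp (fderiv ℝ c x)) x := fun hc z =>
    (ContinuousAlternatingMap.apply ℝ E ℝ z).hasFDerivAt.comp x hc.hasFDerivAt
  have h₁ := ev hab ![v, w]
  have h₂ := ((ev da ![v]).mul (ev db ![w])).sub ((ev da ![w]).mul (ev db ![v]))
  simp only [altWedge_apply_two] at h₁
  have h₃ := congrArg (fun l : E →L[ℝ] ℝ => l u) (h₁.unique h₂)
  refine Eq.trans h₃ ?_
  simp
  ring

/-- The Leibniz rule for `1`-forms on a vector space. -/
theorem extDeriv_altWedge_apply {a b : E → E [⋀^Fin 1]→L[ℝ] ℝ} {x : E}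
    (ha : ContDiffAt ℝ 1 a x) (hb : ContDiffAt ℝ 1 b x) (u v w : E) :
    extDeriv (fun y => altWedge (a y) (b y)) x ![u, v, w] =
      extDeriv a x ![u, v] * b x ![w] - extDeriv a x ![u, w] * b x ![v]
        + extDeriv a x ![v, w] * b x ![u]
        - (a x ![u] * extDeriv b x ![v, w] - a x ![v] * extDeriv b x ![u, w]
          + a x ![w] * extDeriv b x ![u, v]) := by
  simp only [extDeriv_apply_three, fderiv_altWedge_apply ha hb,
    extDeriv_apply_two]
  ring

end Wedge

/-! ### Smooth pullbacks and the Leibniz rule on a manifold -/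

section Manifold

variable {E : Type*} [NormedAddCommGroup E] [NormedSpace ℝ E]
  {M : Type*} [TopologicalSpace M] [ChartedSpace E M] [IsManifold 𝓘(ℝ, E) ∞ M]
  {F : Type*} [NormedAddCommGroup F] [NormedSpace ℝ F]
  {N : Type*} [TopologicalSpace N] [ChartedSpace F N] [IsManifold 𝓘(ℝ, F) ∞ N]

theorem contDiffAt_chartRep_pullback {f : M → N} {θ : DForm F N 1} (hθ : IsSmoothForm θ) {x : M}
    {y : E} (hy : y ∈ (extChartAt 𝓘(ℝ, E) x).target)
    (hf : ContMDiffAt 𝓘(ℝ, E) 𝓘(ℝ, F) ∞ f ((extChartAt 𝓘(ℝ, E) x).symm y)) :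
    ContDiffAt ℝ ∞ (chartRep (pullback f θ) x) y := by
  have hc := mem_extChartAt_source (I := 𝓘(ℝ, F)) (f ((extChartAt 𝓘(ℝ, E) x).symm y))
  have hF := contDiffAt_chart_comp hy hf hc
  refine ContDiffAt.congr_of_eventuallyEq ?_ (eventually_chartRep_pullback θ hy hf hc)
  refine contDiffAt_compContinuousLinearMap_one (ContDiffAt.comp y ?_ hF)
    (hF.fderiv_right (by simp))
  exact (isSmoothForm_iff_contDiffAt.1 hθ) _ _ (mem_extChartAt_target _)

theorem IsSmoothForm.pullback {f : M → N} {θ : DForm F N 1} (hθ : IsSmoothForm θ)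
    (hf : ContMDiff 𝓘(ℝ, E) 𝓘(ℝ, F) ∞ f) : IsSmoothForm (pullback f θ : DForm E M 1) :=
  isSmoothForm_iff_contDiffAt.2 fun _ _ hy => contDiffAt_chartRep_pullback hθ hy (hf _)

/-- The Leibniz rule for `1`-forms. -/
theorem extD_wedge_apply {τ θ : DForm E M 1} (hτ : IsSmoothForm τ) (hθ : IsSmoothForm θ) (x : M)
    (u v w : TangentSpace 𝓘(ℝ, E) x) :
    extD (wedge τ θ) x ![u, v, w] =
      extD τ x ![u, v] * θ x ![w] - extD τ x ![u, w] * θ x ![v] + extD τ x ![v, w] * θ x ![u]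
        - (τ x ![u] * extD θ x ![v, w] - τ x ![v] * extD θ x ![u, w]
          + τ x ![w] * extD θ x ![u, v]) := by
  have hy := mem_extChartAt_target (I := 𝓘(ℝ, E)) x
  have dτ := ((isSmoothForm_iff_contDiffAt.1 hτ) x _ hy).of_le (by simp : (1 : WithTop ℕ∞) ≤ ∞)
  have dθ := ((isSmoothForm_iff_contDiffAt.1 hθ) x _ hy).of_le (by simp : (1 : WithTop ℕ∞) ≤ ∞)
  set L : E →L[ℝ] E := mfderiv 𝓘(ℝ, E) 𝓘(ℝ, E) (extChartAt 𝓘(ℝ, E) x) x with hL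
  -- Values at `x` are read in the preferred chart through its derivative `L`, which reduces the
  -- claim to the model space.
  have e₁ : ∀ (φ : DForm E M 1) (z : E),
      DFunLike.coe (F := E [⋀^Fin 1]→L[ℝ] ℝ) (φ x) ![z] =
        chartRep φ x (extChartAt 𝓘(ℝ, E) x x) ![L z] := by
    intro φ z
    have h := pullback_extChartAt_chartRep φ (mem_extChartAt_source (I := 𝓘(ℝ, E)) x)
    refine (congrArg (fun a : E [⋀^Fin 1]→L[ℝ] ℝ => a ![z]) h).symm.trans ?_
    refine congrArg (chartRep φ x (extChartAt 𝓘(ℝ, E) x x)) ?_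
    ext j
    fin_cases j
    rfl
  have e₂ : ∀ (φ : DForm E M 1) (z z' : E),
      DFunLike.coe (F := E [⋀^Fin 2]→L[ℝ] ℝ) (extD φ x) ![z, z'] =
      extDeriv (chartRep φ x) (extChartAt 𝓘(ℝ, E) x x) ![L z, L z'] := by
    intro φ z z'
    refine congrArg (extDeriv (chartRep φ x) (extChartAt 𝓘(ℝ, E) x x)) ?_
    ext j
    fin_cases j <;> rfl
  have e₃ : DFunLike.coe (F := E [⋀^Fin 3]→L[ℝ] ℝ) (extD (wedge τ θ) x) ![u, v, w] =
      extDeriv (fun y => altWedge (chartRep τ x y) (chartRep θ x y)) (extChartAt 𝓘(ℝ, E) x x)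
        ![L u, L v, L w] := by
    rw [← funext (chartRep_wedge τ θ x)]
    refine congrArg (extDeriv (chartRep (wedge τ θ) x) (extChartAt 𝓘(ℝ, E) x x)) ?_
    ext j
    fin_cases j <;> rfl
  refine e₃.trans ((extDeriv_altWedge_apply dτ dθ _ _ _).trans ?_)
  rw [← e₁ τ u, ← e₁ τ v, ← e₁ τ w, ← e₁ θ u, ← e₁ θ v, ← e₁ θ w, ← e₂ τ u v, ← e₂ τ u w,
    ← e₂ τ v w, ← e₂ θ u v, ← e₂ θ u w, ← e₂ θ v w]
  rfl

end Manifold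

/-! ### Right invariance and structure equations on the solvable group -/

namespace Solv

variable {k : ℝ}

theorem hasFDerivAt_coord (i : Fin 3) (g : EuclideanSpace ℝ (Fin 3)) :
    HasFDerivAt (fun h : EuclideanSpace ℝ (Fin 3) => h i)
      (EuclideanSpace.proj (𝕜 := ℝ) i : EuclideanSpace ℝ (Fin 3) →L[ℝ] ℝ) g :=
  (EuclideanSpace.proj (𝕜 := ℝ) i : EuclideanSpace ℝ (Fin 3) →L[ℝ] ℝ).hasFDerivAt

theorem contDiff_coord (i : Fin 3) :
    ContDiff ℝ ∞ (fun h : EuclideanSpace ℝ (Fin 3) => h i) :=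
  (EuclideanSpace.proj (𝕜 := ℝ) i : EuclideanSpace ℝ (Fin 3) →L[ℝ] ℝ).contDiff

/-- Right multiplication by an element of `G_k`, as a map of the coordinate space. -/
def mulRight (a : Solv k) : EuclideanSpace ℝ (Fin 3) → EuclideanSpace ℝ (Fin 3) :=
  fun g => (HMul.hMul (α := Solv k) g a : Solv k)

theorem contDiff_mulRight (a : Solv k) : ContDiff ℝ ∞ (mulRight a) := by
  refine contDiff_euclidean.2 fun i => ?_
  have h₂ := contDiff_coord 2
  fin_cases i
  · exact (contDiff_coord 0).add
      ((Real.contDiff_exp.comp (contDiff_const.mul h₂)).mul contDiff_const)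
  · exact (contDiff_coord 1).add
      ((Real.contDiff_exp.comp (contDiff_const.mul h₂).neg).mul contDiff_const)
  · exact h₂.add contDiff_const

theorem fderiv_mulRight (a : Solv k) (g v : EuclideanSpace ℝ (Fin 3)) :
    fderiv ℝ (mulRight a) g v = !₂[v 0 + k * Real.exp (k * g 2) * a.x * v 2,
      v 1 - k * Real.exp (-(k * g 2)) * a.y * v 2, v 2] := by
  have hd : DifferentiableAt ℝ (mulRight a) g := (contDiff_mulRight a).differentiable (by simp) g
  have hc : ∀ i, HasFDerivAt (fun h => mulRight a h i)
      ((EuclideanSpace.proj (𝕜 := ℝ) i : EuclideanSpace ℝ (Fin 3) →L[ℝ] ℝ).comp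
        (fderiv ℝ (mulRight a) g)) g := fun i =>
    (hasFDerivAt_coord i _).comp g hd.hasFDerivAt
  have h₀ := hasFDerivAt_coord 0 g
  have h₁ := hasFDerivAt_coord 1 g
  have h₂ := hasFDerivAt_coord 2 g
  ext i
  fin_cases i
  · have := (hc 0).unique (h₀.add ((h₂.const_mul k).exp.mul_const a.x))
    refine (congrArg (fun l : EuclideanSpace ℝ (Fin 3) →L[ℝ] ℝ => l v) this).trans ?_
    simp
    ring
  · have := (hc 1).unique (h₁.add ((h₂.const_mul k).neg.exp.mul_const a.y))
    refine (congrArg (fun l : EuclideanSpace ℝ (Fin 3) →L[ℝ] ℝ => l v) this).trans ?_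
    simp
    ring
  · have := (hc 2).unique (h₂.add_const a.z)
    exact congrArg (fun l : EuclideanSpace ℝ (Fin 3) →L[ℝ] ℝ => l v) this

/-- A form on `G_k` is right invariant if it is preserved by all right translations. -/
def IsRightInvariant {p : ℕ} (θ : DForm (EuclideanSpace ℝ (Fin 3)) (Solv k) p) : Prop :=
  ∀ a : Solv k, pullback (fun g : Solv k => g * a) θ = θ

/-- A form on `G_k`, as a form on the coordinate space. -/
def coordForm {p : ℕ} (θ : DForm (EuclideanSpace ℝ (Fin 3)) (Solv k) p) :
    EuclideanSpace ℝ (Fin 3) → EuclideanSpace ℝ (Fin 3) [⋀^Fin p]→L[ℝ] ℝ := θ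

theorem coordForm_alpha_apply (g : EuclideanSpace ℝ (Fin 3))
    (v : Fin 1 → EuclideanSpace ℝ (Fin 3)) :
    coordForm (alpha (k := k)) g v = v 0 0 - k * g 0 * v 0 2 := rfl

theorem coordForm_beta_apply (g : EuclideanSpace ℝ (Fin 3))
    (v : Fin 1 → EuclideanSpace ℝ (Fin 3)) :
    coordForm (beta (k := k)) g v = v 0 1 + k * g 1 * v 0 2 := rfl

theorem coordForm_gamma_apply (g : EuclideanSpace ℝ (Fin 3))
    (v : Fin 1 → EuclideanSpace ℝ (Fin 3)) :
    coordForm (gamma (k := k)) g v = v 0 2 := rfl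

theorem isRightInvariant_of_coordForm {p : ℕ} {θ : DForm (EuclideanSpace ℝ (Fin 3)) (Solv k) p}
    (h : ∀ (a : Solv k) (g : EuclideanSpace ℝ (Fin 3)) (v : Fin p → EuclideanSpace ℝ (Fin 3)),
      coordForm θ (mulRight a g) (fun i => fderiv ℝ (mulRight a) g (v i)) = coordForm θ g v) :
    IsRightInvariant θ := by
  intro a
  have h' : pullback (mulRight a) (coordForm θ : DForm _ (EuclideanSpace ℝ (Fin 3)) p) =
      coordForm θ := by
    funext g
    rw [pullback_vectorSpace]
    ext v
    exact h a g v
  exact h'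

/-- Translating by `a` adds k e^{kz} `a.x` dz to dx and e^{kz} `a.x` to x, and the two contributions
to dx - kx dz cancel. -/
theorem isRightInvariant_alpha : IsRightInvariant (alpha (k := k)) := by
  refine isRightInvariant_of_coordForm fun a g v => ?_
  have : mulRight a g 0 = g 0 + Real.exp (k * g 2) * a.x := rfl
  simp only [coordForm_alpha_apply, fderiv_mulRight, this]
  simp
  ring

theorem isRightInvariant_beta : IsRightInvariant (beta (k := k)) := by
  refine isRightInvariant_of_coordForm fun a g v => ?_
  have : mulRight a g 1 = g 1 + Real.exp (-(k * g 2)) * a.y := rfl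
  simp only [coordForm_beta_apply, fderiv_mulRight, this]
  simp
  ring

theorem isRightInvariant_gamma : IsRightInvariant (gamma (k := k)) := by
  refine isRightInvariant_of_coordForm fun a g v => ?_
  simp [coordForm_gamma_apply, fderiv_mulRight]

/-- The differentials of the coordinates, as alternating forms on the coordinate space. -/
def coordAlt (i : Fin 3) : EuclideanSpace ℝ (Fin 3) [⋀^Fin 1]→L[ℝ] ℝ :=
  ContinuousAlternatingMap.ofSubsingleton ℝ (EuclideanSpace ℝ (Fin 3)) ℝ (0 : Fin 1)
    (EuclideanSpace.proj i)

theorem coordForm_alpha : coordForm (alpha (k := k)) =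
    fun g => coordAlt 0 - (k * g 0) • coordAlt 2 := rfl

theorem coordForm_beta : coordForm (beta (k := k)) =
    fun g => coordAlt 1 + (k * g 1) • coordAlt 2 := rfl

theorem coordForm_gamma : coordForm (gamma (k := k)) = fun _ => coordAlt 2 := rfl

theorem fderiv_coordForm_alpha (g u : EuclideanSpace ℝ (Fin 3)) :
    fderiv ℝ (coordForm (alpha (k := k))) g u = -((k * u 0) • coordAlt 2) := by
  have h := (((hasFDerivAt_coord 0 g).const_mul k).smul_const (coordAlt 2)).const_sub (coordAlt 0)
  rw [coordForm_alpha, h.fderiv]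
  rfl

theorem fderiv_coordForm_beta (g u : EuclideanSpace ℝ (Fin 3)) :
    fderiv ℝ (coordForm (beta (k := k))) g u = (k * u 1) • coordAlt 2 := by
  have h := (((hasFDerivAt_coord 1 g).const_mul k).smul_const (coordAlt 2)).const_add (coordAlt 1)
  rw [coordForm_beta, h.fderiv]
  rfl

theorem contDiff_coordForm_alpha : ContDiff ℝ ∞ (coordForm (alpha (k := k))) :=
  contDiff_const.sub ((contDiff_const.mul (contDiff_coord 0)).smul contDiff_const)

theorem contDiff_coordForm_beta : ContDiff ℝ ∞ (coordForm (beta (k := k))) :=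
  contDiff_const.add ((contDiff_const.mul (contDiff_coord 1)).smul contDiff_const)

theorem contDiff_coordForm_gamma : ContDiff ℝ ∞ (coordForm (gamma (k := k))) :=
  contDiff_const

theorem vec_two_eq {X : Type*} (v : Fin 2 → X) : v = ![v 0, v 1] := by
  ext i
  fin_cases i <;> rfl

/-- Differentiating dx - kx dz gives -k dx∧dz, and dx may be replaced by α because dz∧dz = 0. -/
theorem extDeriv_coordForm_alpha (g : EuclideanSpace ℝ (Fin 3)) :
    extDeriv (coordForm (alpha (k := k))) g =
      (-k) • altWedge (coordForm (alpha (k := k)) g) (coordForm (gamma (k := k)) g) := by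
  ext v
  rw [vec_two_eq v, extDeriv_apply_two, ContinuousAlternatingMap.smul_apply, altWedge_apply_two]
  simp only [fderiv_coordForm_alpha, coordForm_alpha_apply, coordForm_gamma_apply]
  change -(k * v 0 0 * v 1 2) - -(k * v 1 0 * v 0 2) = _
  simp
  ring

theorem extDeriv_coordForm_beta (g : EuclideanSpace ℝ (Fin 3)) :
    extDeriv (coordForm (beta (k := k))) g =
      k • altWedge (coordForm (beta (k := k)) g) (coordForm (gamma (k := k)) g) := by
  ext v
  rw [vec_two_eq v, extDeriv_apply_two, ContinuousAlternatingMap.smul_apply, altWedge_apply_two]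
  simp only [fderiv_coordForm_beta, coordForm_beta_apply, coordForm_gamma_apply]
  change (k * v 0 1 * v 1 2) - (k * v 1 1 * v 0 2) = _
  simp
  ring

theorem extDeriv_coordForm_gamma (g : EuclideanSpace ℝ (Fin 3)) :
    extDeriv (coordForm (gamma (k := k))) g = 0 := by
  ext v
  rw [coordForm_gamma, vec_two_eq v, extDeriv_apply_two, fderiv_fun_const]
  simp

end Solv

/-! ### The compact quotient: charts, covering map and descended forms -/

section Quotient

variable {k : ℝ} {Γ : Subgroup (Solv k)}

/-- The projection of `G_k` to its quotient, as a map on the coordinate space. -/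
def quotMk (Γ : Subgroup (Solv k)) : EuclideanSpace ℝ (Fin 3) → Solv k ⧸ Γ :=
  fun y => @QuotientGroup.mk (Solv k) _ Γ y

theorem quotMk_mulRight {a : Solv k} (ha : a ∈ Γ) (y : EuclideanSpace ℝ (Fin 3)) :
    quotMk Γ (Solv.mulRight a y) = quotMk Γ y :=
  QuotientGroup.mk_mul_of_mem (α := Solv k) y ha

theorem exists_mulRight_eq {y y' : EuclideanSpace ℝ (Fin 3)} (h : quotMk Γ y = quotMk Γ y') :
    ∃ a ∈ Γ, Solv.mulRight a y = y' :=
  ⟨_, QuotientGroup.eq.1 h, mul_inv_cancel_left (G := Solv k) y y'⟩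

variable [DiscreteTopology Γ]

/-- A chart is a local inverse of the covering map, read in the coordinates of `G_k`. Its inverse is
therefore the covering map itself, whichever chart is taken. -/
theorem symm_apply_of_mem_atlas
    {e : OpenPartialHomeomorph (Solv k ⧸ Γ) (EuclideanSpace ℝ (Fin 3))}
    (he : e ∈ atlas (EuclideanSpace ℝ (Fin 3)) (Solv k ⧸ Γ)) (y : EuclideanSpace ℝ (Fin 3)) :
    e.symm y = quotMk Γ y := by
  obtain ⟨q, rfl⟩ := he
  rw [OpenPartialHomeomorph.coe_trans_symm]
  exact congrFun (IsLocalHomeomorph.localInverseAt_symm _ _) _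

theorem extChartAt_symm_quotient (c : Solv k ⧸ Γ) :
    ((extChartAt (𝓡 3) c).symm : EuclideanSpace ℝ (Fin 3) → Solv k ⧸ Γ) = quotMk Γ :=
  funext fun y => by
    rw [← symm_apply_of_mem_atlas (chart_mem_atlas _ c) y]
    simp

/-- In a chart, the projection is locally a right translation by an element of `Γ`. -/
theorem eventually_chart_quotMk {e : OpenPartialHomeomorph (Solv k ⧸ Γ) (EuclideanSpace ℝ (Fin 3))}
    (he : e ∈ atlas (EuclideanSpace ℝ (Fin 3)) (Solv k ⧸ Γ)) {g : EuclideanSpace ℝ (Fin 3)}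
    (hg : quotMk Γ g ∈ e.source) :
    ∃ a ∈ Γ, ∀ᶠ h in 𝓝 g, e (quotMk Γ h) = Solv.mulRight a h := by
  have h := e.left_inv hg
  rw [symm_apply_of_mem_atlas he] at h
  obtain ⟨a, ha, hga⟩ := exists_mulRight_eq h.symm
  refine ⟨a, ha, ?_⟩
  have hmem : Solv.mulRight a g ∈ e.target := hga ▸ e.map_source hg
  filter_upwards [(Solv.contDiff_mulRight a).continuous.continuousAt.eventually_mem
    (e.open_target.mem_nhds hmem)] with h hh
  rw [← quotMk_mulRight ha h, ← symm_apply_of_mem_atlas he, e.right_inv hh]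

/-- Transition maps are locally right translations by elements of `Γ`, and these are smooth in
coordinates. -/
instance : IsManifold (𝓡 3) ∞ (Solv k ⧸ Γ) := by
  refine isManifold_of_contDiffOn _ _ _ fun e e' he he' y hy => ?_
  obtain ⟨hy, -⟩ := hy
  have hy' : e.symm y ∈ e'.source := by
    have : y ∈ (e.symm ≫ₕ e').source := hy
    rw [OpenPartialHomeomorph.trans_source] at this
    exact this.2
  rw [symm_apply_of_mem_atlas he] at hy'
  obtain ⟨a, -, ha⟩ := eventually_chart_quotMk he' hy'
  refine ContDiffAt.contDiffWithinAt ?_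
  refine (Solv.contDiff_mulRight a).contDiffAt.congr_of_eventuallyEq ?_
  filter_upwards [ha] with h hh
  refine Eq.trans ?_ hh
  change e' (e.symm h) = _
  rw [symm_apply_of_mem_atlas he]

theorem contMDiff_quotMk : ContMDiff (𝓡 3) (𝓡 3) ∞ (quotMk Γ) := by
  intro g
  obtain ⟨a, ha, hga⟩ := eventually_chart_quotMk (chart_mem_atlas _ (quotMk Γ g))
    (mem_chart_source _ (quotMk Γ g))
  have h₁ : ContMDiffAt (𝓡 3) (𝓡 3) ∞ (extChartAt (𝓡 3) (quotMk Γ g)).symm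
      (extChartAt (𝓡 3) (quotMk Γ g) (quotMk Γ g)) :=
    (contMDiffOn_extChartAt_symm _).contMDiffAt (extChartAt_target_mem_nhds _)
  have h₂ : extChartAt (𝓡 3) (quotMk Γ g) (quotMk Γ g) = Solv.mulRight a g := by
    rw [← hga.self_of_nhds]
    simp
  rw [h₂] at h₁
  have h₃ := h₁.comp g (Solv.contDiff_mulRight a).contMDiff.contMDiffAt
  rw [extChartAt_symm_quotient] at h₃
  rwa [show quotMk Γ ∘ Solv.mulRight a = quotMk Γ from funext (quotMk_mulRight ha)] at h₃

/-- The derivative of the projection, as a linear map of the coordinate space. -/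
def quotMkDeriv (Γ : Subgroup (Solv k)) [DiscreteTopology Γ] (g : EuclideanSpace ℝ (Fin 3)) :
    EuclideanSpace ℝ (Fin 3) →L[ℝ] EuclideanSpace ℝ (Fin 3) :=
  mfderiv (𝓡 3) (𝓡 3) (quotMk Γ) g

/-- A chart followed by the inverse translation is a smooth local left inverse of the covering map.
This gives injectivity, and equality of dimensions gives surjectivity. -/
theorem bijective_quotMkDeriv (g : EuclideanSpace ℝ (Fin 3)) :
    Function.Bijective (quotMkDeriv Γ g) := by
  obtain ⟨a, ha, hga⟩ := eventually_chart_quotMk (chart_mem_atlas _ (quotMk Γ g))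
    (mem_chart_source _ (quotMk Γ g))
  set s : Solv k ⧸ Γ → EuclideanSpace ℝ (Fin 3) :=
    Solv.mulRight a⁻¹ ∘ chartAt (EuclideanSpace ℝ (Fin 3)) (quotMk Γ g) with hs
  have hsd : MDifferentiableAt (𝓡 3) (𝓡 3) s (quotMk Γ g) := by
    have h₁ : MDifferentiableAt (𝓡 3) (𝓡 3) (chartAt (EuclideanSpace ℝ (Fin 3)) (quotMk Γ g))
      (quotMk Γ g) := mdifferentiableAt_atlas (chart_mem_atlas _ _) (mem_chart_source _ _)
    exact ((Solv.contDiff_mulRight a⁻¹).contMDiff.mdifferentiable (by simp) _).comp _ h₁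
  have hid : s ∘ quotMk Γ =ᶠ[𝓝 g] id := by
    filter_upwards [hga] with h hh
    rw [hs, Function.comp_apply, Function.comp_apply, hh]
    exact mul_inv_cancel_right (G := Solv k) h a
  have hd := mfderiv_comp g hsd ((contMDiff_quotMk (Γ := Γ)).mdifferentiable (by simp) g)
  have hd' : (mfderiv (𝓡 3) (𝓡 3) (s ∘ quotMk Γ) g :
      EuclideanSpace ℝ (Fin 3) →L[ℝ] EuclideanSpace ℝ (Fin 3)) = .id ℝ _ :=
    hid.mfderiv_eq.trans (mfderiv_id (I := 𝓡 3))
  have hinj : Function.Injective (quotMkDeriv Γ g) := by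
    refine Function.LeftInverse.injective
      (g := fun v : EuclideanSpace ℝ (Fin 3) => mfderiv (𝓡 3) (𝓡 3) s (quotMk Γ g) v) fun v => ?_
    exact congrArg (fun l : EuclideanSpace ℝ (Fin 3) →L[ℝ] EuclideanSpace ℝ (Fin 3) => l v)
      (hd.symm.trans hd')
  exact ⟨hinj, (LinearMap.injective_iff_surjective
    (f := (quotMkDeriv Γ g : EuclideanSpace ℝ (Fin 3) →ₗ[ℝ] EuclideanSpace ℝ (Fin 3)))).1 hinj⟩

/-- `ContinuousLinearMap.inverse` takes the value 0 on non-invertible maps; bijectivity ensures that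
the definition of `descend` never meets this default. -/
theorem inverse_quotMkDeriv_apply (g v : EuclideanSpace ℝ (Fin 3)) :
    (quotMkDeriv Γ g).inverse (quotMkDeriv Γ g v) = v := by
  have hb := bijective_quotMkDeriv (Γ := Γ) g
  refine ContinuousLinearMap.IsInvertible.inverse_apply_self
    ⟨ContinuousLinearEquiv.ofBijective (quotMkDeriv Γ g) (LinearMap.ker_eq_bot.2 hb.1)
      (LinearMap.range_eq_top.2 hb.2), ?_⟩ v
  ext
  rfl

theorem quotMkDeriv_mulRight {a : Solv k} (ha : a ∈ Γ) (g v : EuclideanSpace ℝ (Fin 3)) :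
    quotMkDeriv Γ (Solv.mulRight a g) (fderiv ℝ (Solv.mulRight a) g v) = quotMkDeriv Γ g v := by
  have hd := mfderiv_comp g
    ((contMDiff_quotMk (Γ := Γ)).mdifferentiable (by simp) (Solv.mulRight a g))
    ((Solv.contDiff_mulRight a).contMDiff.mdifferentiable (by simp) g)
  rw [show quotMk Γ ∘ Solv.mulRight a = quotMk Γ from funext (quotMk_mulRight ha),
    mfderiv_eq_fderiv] at hd
  exact (congrArg (fun l : EuclideanSpace ℝ (Fin 3) →L[ℝ] EuclideanSpace ℝ (Fin 3) => l v) hd).symm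

theorem Solv.IsRightInvariant.coordForm_mulRight {p : ℕ}
    {θ : DForm (EuclideanSpace ℝ (Fin 3)) (Solv k) p} (hθ : Solv.IsRightInvariant θ) (a : Solv k)
    (g : EuclideanSpace ℝ (Fin 3)) (v : Fin p → EuclideanSpace ℝ (Fin 3)) :
    Solv.coordForm θ (Solv.mulRight a g) (fun i => fderiv ℝ (Solv.mulRight a) g (v i)) =
      Solv.coordForm θ g v := by
  have h : pullback (Solv.mulRight a)
      (Solv.coordForm θ : DForm _ (EuclideanSpace ℝ (Fin 3)) p) = Solv.coordForm θ := hθ a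
  have hg := congrFun h g
  rw [pullback_vectorSpace] at hg
  exact congrArg (fun τ : EuclideanSpace ℝ (Fin 3) [⋀^Fin p]→L[ℝ] ℝ => τ v) hg

/-- The pullback to `G_k` of the form on the quotient induced by a right invariant form. -/
theorem pullback_quotMk_descend {p : ℕ} {θ : DForm (EuclideanSpace ℝ (Fin 3)) (Solv k) p}
    (hθ : Solv.IsRightInvariant θ) :
    pullback (quotMk Γ) (descend Γ θ) = Solv.coordForm θ := by
  funext g
  set g' : EuclideanSpace ℝ (Fin 3) := (quotMk Γ g).out with hg'
  obtain ⟨a, ha, hga⟩ : ∃ a ∈ Γ, Solv.mulRight a g = g' :=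
    exists_mulRight_eq (QuotientGroup.out_eq' (quotMk Γ g)).symm
  ext v
  refine Eq.trans ?_ (hθ.coordForm_mulRight a g v)
  rw [hga]
  -- The chosen representative `g'` is the translate of `g` by `a`, so passing down at `g` and
  -- lifting back at `g'` is the derivative of that translation; right invariance removes it.
  have key : ∀ w, (quotMkDeriv Γ g').inverse (quotMkDeriv Γ g w) =
      fderiv ℝ (Solv.mulRight a) g w := fun w => by
    rw [← quotMkDeriv_mulRight ha, hga, inverse_quotMkDeriv_apply]
  exact congrArg (Solv.coordForm θ g') (funext fun i => key (v i))

/-- Every inverse chart is the covering map, so smoothness and d on the quotient become computations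
with one global expression in coordinates. -/
theorem chartRep_descend {p : ℕ} {θ : DForm (EuclideanSpace ℝ (Fin 3)) (Solv k) p}
    (hθ : Solv.IsRightInvariant θ) (c : Solv k ⧸ Γ) :
    chartRep (descend Γ θ) c = Solv.coordForm θ := by
  refine Eq.trans ?_ (pullback_quotMk_descend (Γ := Γ) hθ)
  unfold chartRep
  rw [extChartAt_symm_quotient]

theorem isSmoothForm_descend {p : ℕ} {θ : DForm (EuclideanSpace ℝ (Fin 3)) (Solv k) p}
    (hθ : Solv.IsRightInvariant θ) (hs : ContDiff ℝ ∞ (Solv.coordForm θ)) :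
    IsSmoothForm (descend Γ θ) := fun c => by
  rw [chartRep_descend hθ]
  exact hs.contDiffOn

theorem descend_eq_comp {p : ℕ} {θ : DForm (EuclideanSpace ℝ (Fin 3)) (Solv k) p}
    (hθ : Solv.IsRightInvariant θ) (c : Solv k ⧸ Γ) : descend Γ θ c =
      (Solv.coordForm θ (extChartAt (𝓡 3) c c)).compContinuousLinearMap
        (mfderiv (𝓡 3) (𝓡 3) (extChartAt (𝓡 3) c) c) := by
  rw [← pullback_extChartAt_chartRep (descend Γ θ) (mem_extChartAt_source (I := 𝓡 3) c),
    chartRep_descend hθ]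
  rfl

theorem extD_descend {p : ℕ} {θ : DForm (EuclideanSpace ℝ (Fin 3)) (Solv k) p}
    (hθ : Solv.IsRightInvariant θ) (c : Solv k ⧸ Γ) : extD (descend Γ θ) c =
      (extDeriv (Solv.coordForm θ) (extChartAt (𝓡 3) c c)).compContinuousLinearMap
        (mfderiv (𝓡 3) (𝓡 3) (extChartAt (𝓡 3) c) c) := by
  unfold extD
  rw [chartRep_descend hθ]

/-- A structure equation for right invariant `1`-forms descends to the quotient. -/
theorem extD_descend_eq_smul_wedge {θ τ σ : DForm (EuclideanSpace ℝ (Fin 3)) (Solv k) 1}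
    (hθ : Solv.IsRightInvariant θ) (hτ : Solv.IsRightInvariant τ) (hσ : Solv.IsRightInvariant σ)
    {r : ℝ} (h : ∀ g, extDeriv (Solv.coordForm θ) g =
      r • altWedge (Solv.coordForm τ g) (Solv.coordForm σ g)) :
    extD (descend Γ θ) = r • wedge (descend Γ τ) (descend Γ σ) := by
  funext c
  refine (extD_descend hθ c).trans ?_
  rw [h]
  refine congrArg (fun τ : EuclideanSpace ℝ (Fin 3) [⋀^Fin 2]→L[ℝ] ℝ => r • τ)
    (compContinuousLinearMap_altWedge _ _ _) |>.trans ?_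
  exact congrArg (fun τ : EuclideanSpace ℝ (Fin 3) [⋀^Fin 2]→L[ℝ] ℝ => r • τ)
    (congrArg₂ altWedge (descend_eq_comp hτ c).symm (descend_eq_comp hσ c).symm)

theorem extD_descend_alpha : extD (descend Γ Solv.alpha) =
    (-k) • wedge (descend Γ Solv.alpha) (descend Γ Solv.gamma) :=
  extD_descend_eq_smul_wedge Solv.isRightInvariant_alpha Solv.isRightInvariant_alpha
    Solv.isRightInvariant_gamma Solv.extDeriv_coordForm_alpha

theorem extD_descend_beta : extD (descend Γ Solv.beta) =
    k • wedge (descend Γ Solv.beta) (descend Γ Solv.gamma) :=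
  extD_descend_eq_smul_wedge Solv.isRightInvariant_beta Solv.isRightInvariant_beta
    Solv.isRightInvariant_gamma Solv.extDeriv_coordForm_beta

theorem extD_descend_gamma : extD (descend Γ (Solv.gamma (k := k))) = 0 := by
  funext c
  refine (extD_descend Solv.isRightInvariant_gamma c).trans ?_
  rw [Solv.extDeriv_coordForm_gamma]
  rfl

end Quotient

/-! ### One-forms as functionals; signs and differences -/

section LinearAlgebra

variable {E : Type*} [NormedAddCommGroup E] [NormedSpace ℝ E]
  {M : Type*} [TopologicalSpace M] [ChartedSpace E M]

/-- The linear functional on the tangent space given by a `1`-form. -/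
def toFunctional (τ : DForm E M 1) (x : M) : E →L[ℝ] ℝ :=
  (ContinuousAlternatingMap.ofSubsingleton ℝ E ℝ (0 : Fin 1)).symm (τ x)

theorem toFunctional_apply (τ : DForm E M 1) (x : M) (v : TangentSpace 𝓘(ℝ, E) x) :
    τ x ![v] = toFunctional τ x v := by
  have h : (![v] : Fin 1 → TangentSpace 𝓘(ℝ, E) x) = fun _ => v := by
    ext j
    fin_cases j
    rfl
  rw [h]
  rfl

theorem extD_sub {p : ℕ} {θ₁ θ₂ : DForm E M p} (h₁ : IsSmoothForm θ₁) (h₂ : IsSmoothForm θ₂) :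
    extD (θ₁ - θ₂) = extD θ₁ - extD θ₂ := by
  have : θ₁ - θ₂ = θ₁ + (-1 : ℝ) • θ₂ := by
    rw [neg_one_smul, sub_eq_add_neg]
  rw [this, extD_add h₁ (h₂.smul _), extD_smul, neg_one_smul, sub_eq_add_neg]

theorem IsSmoothForm.sub {p : ℕ} {θ₁ θ₂ : DForm E M p} (h₁ : IsSmoothForm θ₁)
    (h₂ : IsSmoothForm θ₂) : IsSmoothForm (θ₁ - θ₂) := fun x => (h₁ x).sub (h₂ x)

theorem IsSmoothForm.neg {p : ℕ} {θ : DForm E M p} (h : IsSmoothForm θ) :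
    IsSmoothForm (-θ) := fun x => (h x).neg

theorem wedge_swap (τ θ : DForm E M 1) : wedge τ θ = -wedge θ τ := by
  funext x
  ext v
  obtain ⟨a, b, rfl⟩ : ∃ a b, v = ![a, b] := ⟨_, _, Solv.vec_two_eq v⟩
  rw [wedge_apply_two]
  refine Eq.trans ?_ (congrArg Neg.neg (wedge_apply_two θ τ x a b)).symm
  ring

end LinearAlgebra

/-! ### Locally conformal symplectic forms from structure equations -/

section LCS

variable {M : Type*} [TopologicalSpace M] [ChartedSpace (EuclideanSpace ℝ (Fin 4)) M]

/-- Four `1`-forms on a `4`-manifold which take all values at a point separate tangent vectors. -/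
theorem eq_zero_of_coframe {α β γ η : DForm (EuclideanSpace ℝ (Fin 4)) M 1} {x : M}
    (hsurj : ∀ a b c d : ℝ, ∃ v : TangentSpace (𝓡 4) x,
      α x ![v] = a ∧ β x ![v] = b ∧ γ x ![v] = c ∧ η x ![v] = d)
    {v : TangentSpace (𝓡 4) x} (hα : α x ![v] = 0) (hβ : β x ![v] = 0) (hγ : γ x ![v] = 0)
    (hη : η x ![v] = 0) : v = 0 := by
  let L : EuclideanSpace ℝ (Fin 4) →ₗ[ℝ] Fin 4 → ℝ := LinearMap.pi
    ![(toFunctional α x : EuclideanSpace ℝ (Fin 4) →ₗ[ℝ] ℝ), toFunctional β x, toFunctional γ x,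
      toFunctional η x]
  have hL : Function.Surjective L := by
    intro r
    obtain ⟨v, h₀, h₁, h₂, h₃⟩ := hsurj (r 0) (r 1) (r 2) (r 3)
    rw [toFunctional_apply] at h₀ h₁ h₂ h₃
    refine ⟨v, funext fun i => ?_⟩
    fin_cases i
    exacts [h₀, h₁, h₂, h₃]
  have hinj : Function.Injective L :=
    (LinearMap.injective_iff_surjective_of_finrank_eq_finrank (by simp)).2 hL
  rw [toFunctional_apply] at hα hβ hγ hη
  have hz : L v = 0 := by
    funext i
    fin_cases i
    exacts [hα, hβ, hγ, hη]
  exact hinj (hz.trans (map_zero L).symm)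

variable {α β γ η : DForm (EuclideanSpace ℝ (Fin 4)) M 1}

theorem lcsForm_apply (c k t₁ t₂ t₃ : ℝ) (x : M) (u v : TangentSpace (𝓡 4) x) :
    (t₁ • wedge α η + t₂ • wedge β γ + t₃ • (c • wedge α β - k • wedge γ η)) x ![u, v] =
      t₁ * (α x ![u] * η x ![v] - α x ![v] * η x ![u])
        + t₂ * (β x ![u] * γ x ![v] - β x ![v] * γ x ![u])
        + t₃ * (c * (α x ![u] * β x ![v] - α x ![v] * β x ![u])
          - k * (γ x ![u] * η x ![v] - γ x ![v] * η x ![u])) := by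
  rw [← wedge_apply_two, ← wedge_apply_two, ← wedge_apply_two, ← wedge_apply_two]
  rfl

/-- A coframe satisfying the structure equations yields locally conformal symplectic forms. -/
theorem isLCSWithLeeForm_of_structure_equations [IsManifold (𝓡 4) ∞ M] {c k : ℝ}
    (sα : IsSmoothForm α) (sβ : IsSmoothForm β) (sγ : IsSmoothForm γ) (sη : IsSmoothForm η)
    (dα : extD α = (-k) • wedge α γ) (dβ : extD β = k • wedge β γ) (dγ : extD γ = 0)
    (dη : extD η = c • wedge α β)
    (hsurj : ∀ (x : M) (a b c d : ℝ), ∃ v : TangentSpace (𝓡 4) x,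
      α x ![v] = a ∧ β x ![v] = b ∧ γ x ![v] = c ∧ η x ![v] = d)
    {t₁ t₂ t₃ : ℝ} (h₁₂ : t₁ * t₂ ≠ 0) (h₃ : t₁ * t₂ ≠ c * k * t₃ ^ 2) :
    IsLCSWithLeeForm
      (t₁ • wedge α η + t₂ • wedge β γ + t₃ • (c • wedge α β - k • wedge γ η)) (-(k • γ)) where
  smooth := (((sα.wedge sη).smul _).add ((sβ.wedge sγ).smul _)).add
    ((((sα.wedge sβ).smul _).sub ((sγ.wedge sη).smul _)).smul _)
  nondegenerate := by
    intro x v hv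
    have ht₁ : t₁ ≠ 0 := left_ne_zero_of_mul h₁₂
    have ht₂ : t₂ ≠ 0 := right_ne_zero_of_mul h₁₂
    have hne : t₁ * t₂ - c * k * t₃ ^ 2 ≠ 0 := sub_ne_zero.2 h₃
    obtain ⟨wA, a₁, a₂, a₃, a₄⟩ := hsurj x 1 0 0 0
    obtain ⟨wB, b₁, b₂, b₃, b₄⟩ := hsurj x 0 1 0 0
    obtain ⟨wC, c₁, c₂, c₃, c₄⟩ := hsurj x 0 0 1 0
    obtain ⟨wX, d₁, d₂, d₃, d₄⟩ := hsurj x 0 0 0 1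
    have eA := hv wA
    have eB := hv wB
    have eC := hv wC
    have eX := hv wX
    rw [lcsForm_apply] at eA eB eC eX
    rw [a₁, a₂, a₃, a₄] at eA
    rw [b₁, b₂, b₃, b₄] at eB
    rw [c₁, c₂, c₃, c₄] at eC
    rw [d₁, d₂, d₃, d₄] at eX
    -- Testing `v` against the dual frame splits into a 2×2 system in β(v), η(v) and another in
    -- α(v), γ(v), both of determinant ±(t₁t₂ - ck t₃²). Elimination gives β(v) and α(v); the
    -- remaining two values follow from t₁, t₂ ≠ 0.
    have hβ : β x ![v] = 0 := by
      refine (mul_eq_zero.1 (?_ : (t₁ * t₂ - c * k * t₃ ^ 2) * β x ![v] = 0)).resolve_left hne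
      linear_combination t₁ * eC + t₃ * k * eA
    have hα : α x ![v] = 0 := by
      refine (mul_eq_zero.1 (?_ : (t₁ * t₂ - c * k * t₃ ^ 2) * α x ![v] = 0)).resolve_left hne
      linear_combination t₂ * eX - t₃ * k * eB
    have hη : η x ![v] = 0 := by
      refine (mul_eq_zero.1 (?_ : t₁ * η x ![v] = 0)).resolve_left ht₁
      linear_combination -eA - t₃ * c * hβ
    have hγ : γ x ![v] = 0 := by
      refine (mul_eq_zero.1 (?_ : t₂ * γ x ![v] = 0)).resolve_left ht₂
      linear_combination -eB + t₃ * c * hα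
    exact eq_zero_of_coframe (hsurj x) hα hβ hγ hη
  smooth_lee := (sγ.smul k).neg
  closed_lee := by
    rw [← neg_smul, extD_smul, dγ, smul_zero]
  extD_eq := by
    have sαη := sα.wedge sη
    have sβγ := sβ.wedge sγ
    have sαβ := sα.wedge sβ
    have sγη := sγ.wedge sη
    have eα : ∀ (x : M) (u v : TangentSpace (𝓡 4) x), extD α x ![u, v] =
        (-k) * (α x ![u] * γ x ![v] - α x ![v] * γ x ![u]) := fun x u v => by
      rw [← wedge_apply_two, dα]; rfl
    have eβ : ∀ (x : M) (u v : TangentSpace (𝓡 4) x), extD β x ![u, v] =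
        k * (β x ![u] * γ x ![v] - β x ![v] * γ x ![u]) := fun x u v => by
      rw [← wedge_apply_two, dβ]; rfl
    have eγ : ∀ (x : M) (u v : TangentSpace (𝓡 4) x), extD γ x ![u, v] = 0 := fun x u v => by
      rw [dγ]; rfl
    have eη : ∀ (x : M) (u v : TangentSpace (𝓡 4) x), extD η x ![u, v] =
        c * (α x ![u] * β x ![v] - α x ![v] * β x ![u]) := fun x u v => by
      rw [← wedge_apply_two, dη]; rfl
    rw [extD_add ((sαη.smul _).add (sβγ.smul _)) (((sαβ.smul _).sub (sγη.smul _)).smul _),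
      extD_add (sαη.smul _) (sβγ.smul _), extD_smul, extD_smul, extD_smul,
      extD_sub (sαβ.smul _) (sγη.smul _), extD_smul, extD_smul]
    funext x
    ext v
    obtain ⟨u, v, w, rfl⟩ : ∃ a b c, v = ![a, b, c] := ⟨v 0, v 1, v 2, by
      ext i
      fin_cases i <;> rfl⟩
    have hR : (-wedge (-(k • γ)) (t₁ • wedge α η + t₂ • wedge β γ +
        t₃ • (c • wedge α β - k • wedge γ η))) x ![u, v, w] =
        -(-(k * γ x ![u]) * (t₁ • wedge α η + t₂ • wedge β γ +
            t₃ • (c • wedge α β - k • wedge γ η)) x ![v, w]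
          - -(k * γ x ![v]) * (t₁ • wedge α η + t₂ • wedge β γ +
            t₃ • (c • wedge α β - k • wedge γ η)) x ![u, w]
          + -(k * γ x ![w]) * (t₁ • wedge α η + t₂ • wedge β γ +
            t₃ • (c • wedge α β - k • wedge γ η)) x ![u, v]) :=
      congrArg Neg.neg (wedge_apply_three _ _ x u v w)
    have hLe : (t₁ • extD (wedge α η) + t₂ • extD (wedge β γ) +
        t₃ • (c • extD (wedge α β) - k • extD (wedge γ η))) x ![u, v, w] =
        t₁ * extD (wedge α η) x ![u, v, w] + t₂ * extD (wedge β γ) x ![u, v, w] +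
        t₃ * (c * extD (wedge α β) x ![u, v, w] - k * extD (wedge γ η) x ![u, v, w]) := rfl
    refine hLe.trans (Eq.trans ?_ hR.symm)
    rw [extD_wedge_apply sα sη, extD_wedge_apply sβ sγ, extD_wedge_apply sα sβ,
      extD_wedge_apply sγ sη]
    rw [lcsForm_apply, lcsForm_apply, lcsForm_apply]
    -- After the structure equations are inserted, both sides are polynomials in the values of the
    -- four forms on `u`, `v`, `w`.
    simp only [eα, eβ, eγ, eη]
    ring

end LCS

/-! ### Orbits of the circle action and fibres of the bundle -/

section CircleAction

variable {M : Type*} [TopologicalSpace M] [ChartedSpace (EuclideanSpace ℝ (Fin 4)) M]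
  [MulAction Circle M]
  {N : Type*} [TopologicalSpace N] [ChartedSpace (EuclideanSpace ℝ (Fin 3)) N] {π : M → N}

/-- The circle, parametrized by `ℝ / ℤ`. -/
def circlePath (t : ℝ) : Circle := Circle.exp (2 * Real.pi * t)

theorem circlePath_add (s t : ℝ) : circlePath (s + t) = circlePath s * circlePath t := by
  rw [circlePath, mul_add, Circle.exp_add]
  rfl

theorem circlePath_zero : circlePath 0 = 1 := by
  rw [circlePath, mul_zero, Circle.exp_zero]

theorem circlePath_one : circlePath 1 = 1 := by
  rw [circlePath, mul_one, Circle.exp_two_pi]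

theorem exists_circlePath_eq (z : Circle) : ∃ t, circlePath t = z := by
  refine ⟨Complex.arg z / (2 * Real.pi), ?_⟩
  rw [circlePath, mul_div_cancel₀ _ Real.two_pi_pos.ne', Circle.exp_arg]

theorem contMDiff_circlePath : ContMDiff 𝓘(ℝ, ℝ) (𝓡 1) ∞ circlePath :=
  contMDiff_circleExp.comp (contDiff_const.mul contDiff_id).contMDiff

namespace IsPrincipalCircleBundle

theorem contMDiff_orbit (hπ : IsPrincipalCircleBundle π) (m : M) :
    ContMDiff 𝓘(ℝ, ℝ) (𝓡 4) ∞ (fun t : ℝ => circlePath t • m) :=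
  hπ.contMDiff_smul.comp (contMDiff_circlePath.prodMk contMDiff_const)

/-- The velocity of an orbit is the fundamental field. -/
theorem mfderiv_orbit (hπ : IsPrincipalCircleBundle π) (m : M) (t : ℝ) :
    (mfderiv 𝓘(ℝ, ℝ) (𝓡 4) (fun t : ℝ => circlePath t • m) t (1 : ℝ) : EuclideanSpace ℝ (Fin 4)) =
      fundamentalField (circlePath t • m) := by
  -- The fundamental field is a velocity at time 0, so the orbit is restarted at its point of time
  -- `t`.
  have h₁ : (fun s : ℝ => circlePath s • m) =
      (fun s : ℝ => circlePath s • circlePath t • m) ∘ fun s => s - t := by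
    funext s
    rw [Function.comp_apply, smul_smul, ← circlePath_add, sub_add_cancel]
  have h₂ : MDifferentiableAt 𝓘(ℝ, ℝ) 𝓘(ℝ, ℝ) (fun s : ℝ => s - t) t :=
    (differentiableAt_id.sub_const t).mdifferentiableAt
  have h₃ := mfderiv_comp (f := fun s : ℝ => s - t) t
    ((hπ.contMDiff_orbit (circlePath t • m)).mdifferentiable (by simp) (t - t)) h₂
  have h₄ : (mfderiv 𝓘(ℝ, ℝ) 𝓘(ℝ, ℝ) (fun s : ℝ => s - t) t (1 : ℝ) : ℝ) = 1 := by
    rw [mfderiv_eq_fderiv, fderiv_sub_const, fderiv_fun_id]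
    rfl
  -- The time is generalized because `t - t` is 0 only propositionally, while the tangent space
  -- depends on it.
  have h₅ : ∀ r v : ℝ, r = 0 → v = 1 → (mfderiv 𝓘(ℝ, ℝ) (𝓡 4)
      (fun s : ℝ => circlePath s • circlePath t • m) r v : EuclideanSpace ℝ (Fin 4)) =
      fundamentalField (circlePath t • m) := by
    rintro _ _ rfl rfl
    rfl
  rw [h₁]
  exact (congrArg (fun l : ℝ →L[ℝ] EuclideanSpace ℝ (Fin 4) => l 1) h₃).trans
    (h₅ _ _ (sub_self t) h₄)

/-- The fundamental field is vertical. -/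
theorem mfderiv_proj_fundamentalField (hπ : IsPrincipalCircleBundle π) (m : M) :
    mfderiv (𝓡 4) (𝓡 3) π m (fundamentalField m) = 0 := by
  have h₁ : π ∘ (fun t : ℝ => circlePath t • m) = fun _ => π m :=
    funext fun t => hπ.proj_smul _ _
  have h₂ := mfderiv_comp (0 : ℝ) (hπ.contMDiff_proj.mdifferentiable (by simp) (circlePath 0 • m))
    ((hπ.contMDiff_orbit m).mdifferentiable (by simp) 0)
  rw [h₁, mfderiv_const] at h₂
  have h₃ := congrArg (fun l : ℝ →L[ℝ] EuclideanSpace ℝ (Fin 3) => l 1) h₂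
  have h₄ : circlePath 0 • m = m := by rw [circlePath_zero, one_smul]
  have h₅ : mfderiv (𝓡 4) (𝓡 3) π (circlePath 0 • m)
      (mfderiv 𝓘(ℝ, ℝ) (𝓡 4) (fun t : ℝ => circlePath t • m) 0 (1 : ℝ)) = 0 := h₃.symm
  rw [h₄] at h₅
  exact h₅

theorem surjective (hπ : IsPrincipalCircleBundle π) : Function.Surjective π := by
  intro b
  obtain ⟨U, -, hb, e, hs, ht, -, -, h₁, -⟩ := hπ.locally_trivial b
  have hmem : (b, (1 : Circle)) ∈ e.target := by
    rw [ht]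
    exact ⟨hb, mem_univ _⟩
  refine ⟨e.symm (b, 1), ?_⟩
  rw [← h₁ _ (e.map_target hmem), e.right_inv hmem]

/-- The circle acts transitively on the fibres. -/
theorem exists_smul_eq (hπ : IsPrincipalCircleBundle π) {m m' : M} (h : π m = π m') :
    ∃ z : Circle, z • m = m' := by
  obtain ⟨U, -, hb, e, hs, ht, -, -, h₁, h₂⟩ := hπ.locally_trivial (π m)
  have hm : m ∈ e.source := by rwa [hs]
  have hm' : m' ∈ e.source := by
    rw [hs, mem_preimage, ← h]
    exact hb
  refine ⟨(e m').2 * (e m).2⁻¹, ?_⟩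
  have hz : ((e m').2 * (e m).2⁻¹) • m ∈ e.source := by
    rw [hs, mem_preimage, hπ.proj_smul]
    exact hb
  refine e.injOn hz hm' (Prod.ext ?_ ?_)
  · rw [h₁ _ hz, h₁ _ hm', hπ.proj_smul, h]
  · rw [h₂ m hm, inv_mul_cancel_right]

end IsPrincipalCircleBundle

end CircleAction

/-! ### Local sections and the coframe on the total space -/

section LocalSections

variable {k : ℝ} {Γ : Subgroup (Solv k)} [DiscreteTopology Γ]
  {M : Type*} [TopologicalSpace M] [ChartedSpace (EuclideanSpace ℝ (Fin 4)) M]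
  {π : M → Solv k ⧸ Γ}

/-- The value of a pulled back right invariant form on a lift of a tangent vector of `G_k`. -/
theorem pullback_descend_apply {θ : DForm (EuclideanSpace ℝ (Fin 3)) (Solv k) 1}
    (hθ : Solv.IsRightInvariant θ) {m : M} {g : EuclideanSpace ℝ (Fin 3)}
    (hg : quotMk Γ g = π m) {u : TangentSpace (𝓡 4) m} {w : EuclideanSpace ℝ (Fin 3)}
    (hu : (mfderiv (𝓡 4) (𝓡 3) π m u : EuclideanSpace ℝ (Fin 3)) = quotMkDeriv Γ g w) :
    pullback π (descend Γ θ) m ![u] = Solv.coordForm θ g ![w] := by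
  have h₁ := congrArg (fun τ : EuclideanSpace ℝ (Fin 3) [⋀^Fin 1]→L[ℝ] ℝ => τ ![w])
    (congrFun (pullback_quotMk_descend (Γ := Γ) hθ) g)
  refine Eq.trans ?_ ((toFunctional_apply (pullback (quotMk Γ) (descend Γ θ)) g w).symm.trans h₁)
  rw [toFunctional_apply]
  change toFunctional (descend Γ θ) (π m) (mfderiv (𝓡 4) (𝓡 3) π m u) =
    toFunctional (descend Γ θ) (quotMk Γ g) (quotMkDeriv Γ g w)
  rw [hg]
  exact congrArg (toFunctional (descend Γ θ) (π m)) hu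

variable [MulAction Circle M]

/-- Through every point of the bundle there is a local section over an open subset of `G_k`. -/
theorem IsPrincipalCircleBundle.exists_section (hπ : IsPrincipalCircleBundle π) (m : M) :
    ∃ (V : Set (EuclideanSpace ℝ (Fin 3))) (s : EuclideanSpace ℝ (Fin 3) → M), IsOpen V ∧
      (∀ g, quotMk Γ g = π m → g ∈ V ∧ s g = m) ∧
      (∀ y ∈ V, ContMDiffAt (𝓡 3) (𝓡 4) ∞ s y) ∧ ∀ y ∈ V, π (s y) = quotMk Γ y := by
  obtain ⟨U, hU, hb, e, hs, ht, -, he, h₁, -⟩ := hπ.locally_trivial (π m)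
  have hm : m ∈ e.source := by rwa [hs]
  have hV : IsOpen (quotMk Γ ⁻¹' U) := hU.preimage contMDiff_quotMk.continuous
  have hmem : ∀ y ∈ quotMk Γ ⁻¹' U, (quotMk Γ y, (e m).2) ∈ e.target := fun y hy => by
    rw [ht]
    exact ⟨hy, mem_univ _⟩
  refine ⟨quotMk Γ ⁻¹' U, fun y => e.symm (quotMk Γ y, (e m).2), hV, fun g hg => ⟨?_, ?_⟩,
    fun y hy => ?_, fun y hy => ?_⟩
  · rwa [mem_preimage, hg]
  · change e.symm (quotMk Γ g, (e m).2) = m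
    rw [hg, ← h₁ m hm, Prod.mk.eta, e.left_inv hm]
  · exact (he.contMDiffAt (e.open_target.mem_nhds (hmem y hy))).comp y
      (contMDiff_quotMk.contMDiffAt.prodMk contMDiffAt_const)
  · rw [← h₁ _ (e.map_target (hmem y hy)), e.right_inv (hmem y hy)]

theorem pullback_descend_fundamentalField (hπ : IsPrincipalCircleBundle π)
    (θ : DForm (EuclideanSpace ℝ (Fin 3)) (Solv k) 1) (m : M) :
    pullback π (descend Γ θ) m ![fundamentalField m] = 0 := by
  rw [toFunctional_apply]
  change toFunctional (descend Γ θ) (π m) (mfderiv (𝓡 4) (𝓡 3) π m (fundamentalField m)) = 0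
  rw [hπ.mfderiv_proj_fundamentalField]
  exact map_zero _

/-- A local section lifts a vector of `G_k` with prescribed α, β, γ. Adding a multiple of the
fundamental field adjusts η without changing these, since they vanish on vertical vectors. -/
theorem exists_coframe_eq (hπ : IsPrincipalCircleBundle π)
    {η : DForm (EuclideanSpace ℝ (Fin 4)) M 1} (hη : IsConnectionForm η) (m : M) (a b c d : ℝ) :
    ∃ v : TangentSpace (𝓡 4) m, pullback π (descend Γ Solv.alpha) m ![v] = a ∧
      pullback π (descend Γ Solv.beta) m ![v] = b ∧
      pullback π (descend Γ Solv.gamma) m ![v] = c ∧ η m ![v] = d := by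
  obtain ⟨V, s, hV, hsm, hs, hπs⟩ := hπ.exists_section m
  obtain ⟨g, hg⟩ : ∃ g, quotMk Γ g = π m := QuotientGroup.mk_surjective (π m)
  obtain ⟨hgV, hsg⟩ := hsm g hg
  subst hsg
  -- Solution of dx - kx dz = a, dy + ky dz = b, dz = c at the point `g`.
  set w : EuclideanSpace ℝ (Fin 3) := !₂[a + k * g 0 * c, b - k * g 1 * c, c] with hw
  set u : TangentSpace (𝓡 4) (s g) := mfderiv (𝓡 3) (𝓡 4) s g w with hu
  have hd : (mfderiv (𝓡 4) (𝓡 3) π (s g) u : EuclideanSpace ℝ (Fin 3)) = quotMkDeriv Γ g w := by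
    have h₁ := mfderiv_comp g (hπ.contMDiff_proj.mdifferentiable (by simp) (s g))
      ((hs g hgV).mdifferentiableAt (by simp))
    have h₂ : π ∘ s =ᶠ[𝓝 g] quotMk Γ := by
      filter_upwards [hV.mem_nhds hgV] with y hy using hπs y hy
    have h₃ : (mfderiv (𝓡 3) (𝓡 3) (π ∘ s) g : EuclideanSpace ℝ (Fin 3) →L[ℝ]
      EuclideanSpace ℝ (Fin 3)) = quotMkDeriv Γ g := h₂.mfderiv_eq
    exact congrArg (fun l : EuclideanSpace ℝ (Fin 3) →L[ℝ] EuclideanSpace ℝ (Fin 3) => l w)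
      (h₁.symm.trans h₃)
  have hα := pullback_descend_apply Solv.isRightInvariant_alpha hg hd
  have hβ := pullback_descend_apply Solv.isRightInvariant_beta hg hd
  have hγ := pullback_descend_apply Solv.isRightInvariant_gamma hg hd
  have hX := hη.apply_fundamentalField (s g)
  have hαX := pullback_descend_fundamentalField hπ Solv.alpha (s g)
  have hβX := pullback_descend_fundamentalField hπ Solv.beta (s g)
  have hγX := pullback_descend_fundamentalField hπ Solv.gamma (s g)
  rw [Solv.coordForm_alpha_apply] at hα
  rw [Solv.coordForm_beta_apply] at hβ
  rw [Solv.coordForm_gamma_apply] at hγ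
  rw [toFunctional_apply] at hα hβ hγ hX hαX hβX hγX
  have key : ∀ φ : EuclideanSpace ℝ (Fin 4) →L[ℝ] ℝ,
      φ (u + (d - η (s g) ![u]) • fundamentalField (s g)) =
        φ u + (d - η (s g) ![u]) * φ (fundamentalField (s g)) := fun φ =>
    (map_add φ _ _).trans (congrArg _ (map_smul φ _ _))
  refine ⟨u + (d - η (s g) ![u]) • fundamentalField (s g), ?_, ?_, ?_, ?_⟩ <;>
    rw [toFunctional_apply]
  · refine (key _).trans ?_
    rw [hα, hαX, hw]
    simp
  · refine (key _).trans ?_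
    rw [hβ, hβX, hw]
    simp
  · refine (key _).trans ?_
    rw [hγ, hγX, hw]
    simp
  · refine (key _).trans ?_
    rw [hX, toFunctional_apply]
    ring

end LocalSections

/-! ### Green's theorem over a cylinder -/

section Green

variable {E : Type*} [NormedAddCommGroup E] [NormedSpace ℝ E]

/-- Green's theorem for a `1`-form on `E × ℝ` over a rectangle spanned by a vector of `E` and the
unit interval, when the contributions of the two sides parallel to `E` cancel. -/
theorem integral_eq_add_of_extDeriv_eq {V : Set E}
    {ψ : E × ℝ → (E × ℝ) [⋀^Fin 1]→L[ℝ] ℝ} (hψ : ∀ y ∈ V, ∀ t, DifferentiableAt ℝ ψ (y, t))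
    {w : E} {T : ℝ} (hd : ∀ y ∈ V, ∀ t, extDeriv ψ (y, t) ![(w, 0), (0, 1)] = T)
    (hper : ∀ y ∈ V, ψ (y, 1) ![(w, 0)] = ψ (y, 0) ![(w, 0)]) {g : E} {r : ℝ}
    (hr : ∀ q ∈ uIcc 0 r, g + q • w ∈ V) :
    ∫ t in (0 : ℝ)..1, ψ (g + r • w, t) ![(0, 1)] =
      (∫ t in (0 : ℝ)..1, ψ (g, t) ![(0, 1)]) + r * T := by
  let l : ℝ × ℝ → E × ℝ := fun p => (g + p.1 • w, p.2)
  let l' : ℝ × ℝ →L[ℝ] E × ℝ :=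
    ((ContinuousLinearMap.fst ℝ ℝ ℝ).smulRight w).prod (ContinuousLinearMap.snd ℝ ℝ ℝ)
  have hl : ∀ p, HasFDerivAt l l' p := fun p =>
    (((ContinuousLinearMap.fst ℝ ℝ ℝ).smulRight w).hasFDerivAt.const_add g).prodMk
      (ContinuousLinearMap.snd ℝ ℝ ℝ).hasFDerivAt
  have hmem : ∀ p ∈ uIcc 0 r ×ˢ uIcc (0 : ℝ) 1, (l p).1 ∈ V := fun p hp => hr p.1 hp.1
  have hder : ∀ (v : Fin 1 → E × ℝ), ∀ p ∈ uIcc 0 r ×ˢ uIcc (0 : ℝ) 1,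
      HasFDerivAt (fun p => ψ (l p) v)
        ((ContinuousAlternatingMap.apply ℝ (E × ℝ) ℝ v) ∘L (fderiv ℝ ψ (l p)) ∘L l') p :=
    fun v p hp => (ContinuousAlternatingMap.apply ℝ (E × ℝ) ℝ v).hasFDerivAt.comp p
      ((hψ _ (hmem p hp) _).hasFDerivAt.comp p (hl p))
  have hsub : Ioo (min 0 r) (max 0 r) ×ˢ Ioo (min (0 : ℝ) 1) (max 0 1) ⊆
      uIcc 0 r ×ˢ uIcc (0 : ℝ) 1 := prod_mono Ioo_subset_Icc_self Ioo_subset_Icc_self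
  have l₁ : l' (1, 0) = (w, 0) := by simp [l']
  have l₂ : l' (0, 1) = (0, 1) := by simp [l']
  have hT : ∀ p ∈ uIcc 0 r ×ˢ uIcc (0 : ℝ) 1,
      ((ContinuousAlternatingMap.apply ℝ (E × ℝ) ℝ ![(0, 1)]) ∘L (fderiv ℝ ψ (l p)) ∘L l') (1, 0) +
      (-((ContinuousAlternatingMap.apply ℝ (E × ℝ) ℝ ![(w, 0)]) ∘L (fderiv ℝ ψ (l p)) ∘L l'))
        (0, 1) = T := by
    intro p hp
    rw [← hd _ (hmem p hp) (l p).2, extDeriv_apply_two]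
    change fderiv ℝ ψ (l p) (l' (1, 0)) ![(0, 1)] + -(fderiv ℝ ψ (l p) (l' (0, 1)) ![(w, 0)]) = _
    rw [l₁, l₂]
    rfl
  -- The plane field with components ψ(∂/∂t) and -ψ(w) has divergence dψ(w, ∂/∂t) = `T`.
  -- Integrability follows because the divergence is constant on the rectangle; ψ itself is only
  -- assumed differentiable.
  have hgreen := MeasureTheory.integral2_divergence_prod_of_hasFDerivAt
    (fun p => ψ (l p) ![(0, 1)]) (fun p => -ψ (l p) ![(w, 0)])
    (fun p => (ContinuousAlternatingMap.apply ℝ (E × ℝ) ℝ ![(0, 1)]) ∘L (fderiv ℝ ψ (l p)) ∘L l')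
    (fun p => -((ContinuousAlternatingMap.apply ℝ (E × ℝ) ℝ ![(w, 0)]) ∘L
      (fderiv ℝ ψ (l p)) ∘L l')) 0 0 r 1
    (fun p hp => (hder _ p hp).continuousAt.continuousWithinAt)
    (fun p hp => (hder _ p hp).neg.continuousAt.continuousWithinAt)
    (fun p hp => hder _ p (hsub hp)) (fun p hp => (hder _ p (hsub hp)).neg)
    (MeasureTheory.IntegrableOn.congr_fun (f := fun _ => T)
      (continuousOn_const.integrableOn_compact (isCompact_uIcc.prod isCompact_uIcc))
      (fun p hp => (hT p hp).symm) (measurableSet_uIcc.prod measurableSet_uIcc))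
  have hleft : (∫ x in (0 : ℝ)..r, ∫ y in (0 : ℝ)..1,
      ((ContinuousAlternatingMap.apply ℝ (E × ℝ) ℝ ![(0, 1)]) ∘L (fderiv ℝ ψ (l (x, y))) ∘L l')
        (1, 0) +
      (-((ContinuousAlternatingMap.apply ℝ (E × ℝ) ℝ ![(w, 0)]) ∘L
        (fderiv ℝ ψ (l (x, y))) ∘L l')) (0, 1)) = r * T := by
    rw [intervalIntegral.integral_congr (g := fun _ => T)]
    · simp
    · intro x hx
      change (∫ y in (0 : ℝ)..1, _) = T
      rw [intervalIntegral.integral_congr (g := fun _ => T)]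
      · simp
      · exact fun y hy => hT (x, y) ⟨hx, hy⟩
  have hsides : (∫ x in (0 : ℝ)..r, -ψ (l (x, 1)) ![(w, 0)]) =
      ∫ x in (0 : ℝ)..r, -ψ (l (x, 0)) ![(w, 0)] :=
    intervalIntegral.integral_congr fun x hx => congrArg Neg.neg (hper _ (hr x hx))
  rw [hleft, hsides, sub_self, zero_add] at hgreen
  have h₀ : ∀ t, l (0, t) = (g, t) := fun t => by simp [l]
  simp only [h₀] at hgreen
  change r * T = (∫ t in (0 : ℝ)..1, ψ (g + r • w, t) ![(0, 1)]) - _ at hgreen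
  linarith

end Green

/-! ### Manifold notions specialized to a vector space as source -/

section VectorSpace

variable {E : Type*} [NormedAddCommGroup E] [NormedSpace ℝ E]
  {F : Type*} [NormedAddCommGroup F] [NormedSpace ℝ F]
  {N : Type*} [TopologicalSpace N] [ChartedSpace F N] [IsManifold 𝓘(ℝ, F) ∞ N]

/-- A form on a vector space is its own expression in a chart. -/
theorem chartRep_vectorSpace {p : ℕ} (ψ : E → E [⋀^Fin p]→L[ℝ] ℝ) (x : E) :
    chartRep (ψ : DForm E E p) x = ψ := by
  funext y
  unfold chartRep
  rw [extChartAt_model_space_eq_id]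
  refine (pullback_vectorSpace (fun y => y) ψ y).trans ?_
  rw [fderiv_fun_id]
  rfl

theorem extD_vectorSpace {p : ℕ} (ψ : E → E [⋀^Fin p]→L[ℝ] ℝ) (x : E) :
    extD (ψ : DForm E E p) x = extDeriv ψ x := by
  unfold extD
  rw [chartRep_vectorSpace, extChartAt_model_space_eq_id]
  change (extDeriv ψ x).compContinuousLinearMap (mfderiv 𝓘(ℝ, E) 𝓘(ℝ, E) (fun y : E => y) x) = _
  rw [mfderiv_eq_fderiv, fderiv_fun_id]
  rfl

theorem contDiffAt_pullback {f : E → N} {θ : DForm F N 1} (hθ : IsSmoothForm θ) {x : E}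
    (hf : ContMDiffAt 𝓘(ℝ, E) 𝓘(ℝ, F) ∞ f x) :
    ContDiffAt ℝ ∞ (F := E [⋀^Fin 1]→L[ℝ] ℝ) (pullback (E := E) (M := E) f θ) x := by
  have h := contDiffAt_chartRep_pullback (x := x) (y := x) hθ
    (by rw [extChartAt_model_space_eq_id]; exact mem_univ x)
    (by rw [extChartAt_model_space_eq_id]; exact hf)
  have e : chartRep (pullback (E := E) (M := E) f θ) x = pullback f θ := chartRep_vectorSpace _ x
  rwa [e] at h

theorem extDeriv_pullback_manifold {p : ℕ} {f : E → N} {θ : DForm F N p} (hθ : IsSmoothForm θ)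
    {x : E} (hf : ContMDiffAt 𝓘(ℝ, E) 𝓘(ℝ, F) ∞ f x) :
    extDeriv (E := E) (F := ℝ) (pullback (E := E) (M := E) f θ) x = pullback f (extD θ) x :=
  (extD_vectorSpace _ x).symm.trans (extD_pullback hθ hf)

end VectorSpace

/-! ### Integration over the fibres -/

section FibreIntegral

variable {M : Type*} [TopologicalSpace M] [ChartedSpace (EuclideanSpace ℝ (Fin 4)) M]
  [MulAction Circle M]

/-- The integral of a `1`-form over the circle through a point. -/
def fibreIntegral (θ : DForm (EuclideanSpace ℝ (Fin 4)) M 1) (m : M) : ℝ :=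
  ∫ t in (0 : ℝ)..1, θ (circlePath t • m) ![fundamentalField (circlePath t • m)]

/-- Moving the base point along its orbit shifts the time in a 1-periodic integrand, which leaves
the integral over a period unchanged. -/
theorem fibreIntegral_smul (θ : DForm (EuclideanSpace ℝ (Fin 4)) M 1) (z : Circle) (m : M) :
    fibreIntegral θ (z • m) = fibreIntegral θ m := by
  obtain ⟨a, rfl⟩ := exists_circlePath_eq z
  let φ : ℝ → ℝ := fun t => θ (circlePath t • m) ![fundamentalField (circlePath t • m)]
  have hφ : Function.Periodic φ 1 := fun t => by
    change θ (circlePath (t + 1) • m) ![fundamentalField (circlePath (t + 1) • m)] = φ t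
    rw [circlePath_add, circlePath_one, mul_one]
  have h₁ : fibreIntegral θ (circlePath a • m) = ∫ t in (0 : ℝ)..1, φ (t + a) := by
    refine intervalIntegral.integral_congr fun t _ => ?_
    change θ _ _ = θ (circlePath (t + a) • m) ![fundamentalField (circlePath (t + a) • m)]
    rw [circlePath_add, mul_smul]
  rw [h₁, intervalIntegral.integral_comp_add_right, zero_add, add_comm,
    hφ.intervalIntegral_add_eq a 0, zero_add]
  rfl

end FibreIntegral

/-! ### The boundedness obstruction to a primitive -/

section Primitive

variable {k : ℝ} {Γ : Subgroup (Solv k)} [DiscreteTopology Γ]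
  {M : Type*} [TopologicalSpace M] [ChartedSpace (EuclideanSpace ℝ (Fin 4)) M]
  [IsManifold (𝓡 4) ∞ M] [MulAction Circle M] {π : M → Solv k ⧸ Γ}

/-- Locally on `G_k`, the bundle is parametrized by `(y, t) ↦ exp(2πit) • s y`; this is the
pullback of a `1`-form under such a parametrization. -/
theorem IsPrincipalCircleBundle.exists_local_form (hπ : IsPrincipalCircleBundle π)
    {θ : DForm (EuclideanSpace ℝ (Fin 4)) M 1} (hθ : IsSmoothForm θ)
    {w : EuclideanSpace ℝ (Fin 3)} {T : ℝ}
    (hT : ∀ (g : EuclideanSpace ℝ (Fin 3)) (m : M), quotMk Γ g = π m →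
      ∀ u : TangentSpace (𝓡 4) m,
        (mfderiv (𝓡 4) (𝓡 3) π m u : EuclideanSpace ℝ (Fin 3)) = quotMkDeriv Γ g w →
        extD θ m ![u, fundamentalField m] = T)
    (g : EuclideanSpace ℝ (Fin 3)) :
    ∃ (V : Set (EuclideanSpace ℝ (Fin 3))) (s : EuclideanSpace ℝ (Fin 3) → M)
      (ψ : EuclideanSpace ℝ (Fin 3) × ℝ → (EuclideanSpace ℝ (Fin 3) × ℝ) [⋀^Fin 1]→L[ℝ] ℝ),
      IsOpen V ∧ g ∈ V ∧ (∀ y ∈ V, π (s y) = quotMk Γ y) ∧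
      (∀ y ∈ V, ∀ t, DifferentiableAt ℝ ψ (y, t)) ∧
      (∀ y ∈ V, ∀ t, extDeriv ψ (y, t) ![(w, 0), (0, 1)] = T) ∧
      (∀ y ∈ V, ψ (y, 1) ![(w, 0)] = ψ (y, 0) ![(w, 0)]) ∧
      (∀ y ∈ V, fibreIntegral θ (s y) = ∫ t in (0 : ℝ)..1, ψ (y, t) ![(0, 1)]) := by
  obtain ⟨m₀, hm₀⟩ := hπ.surjective (quotMk Γ g)
  obtain ⟨V, s, hV, hsm, hs, hπs⟩ := hπ.exists_section m₀
  let Φ : EuclideanSpace ℝ (Fin 3) × ℝ → M := fun q => circlePath q.2 • s q.1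
  have hΦ : ∀ y ∈ V, ∀ t, ContMDiffAt 𝓘(ℝ, EuclideanSpace ℝ (Fin 3) × ℝ) (𝓡 4) ∞ Φ (y, t) := by
    intro y hy t
    have h₁ : ContMDiffAt 𝓘(ℝ, EuclideanSpace ℝ (Fin 3) × ℝ) (𝓡 1) ∞
        (fun q : EuclideanSpace ℝ (Fin 3) × ℝ => circlePath q.2) (y, t) :=
      (contMDiff_circlePath.comp contDiff_snd.contMDiff).contMDiffAt
    have h₂ : ContMDiffAt 𝓘(ℝ, EuclideanSpace ℝ (Fin 3) × ℝ) (𝓡 4) ∞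
        (fun q : EuclideanSpace ℝ (Fin 3) × ℝ => s q.1) (y, t) :=
      ContMDiffAt.comp (y, t) (hs y hy) contDiff_fst.contMDiff.contMDiffAt
    exact hπ.contMDiff_smul.contMDiffAt.comp (y, t) (h₁.prodMk h₂)
  let ψ : EuclideanSpace ℝ (Fin 3) × ℝ → (EuclideanSpace ℝ (Fin 3) × ℝ) [⋀^Fin 1]→L[ℝ] ℝ :=
    pullback (E := EuclideanSpace ℝ (Fin 3) × ℝ) (M := EuclideanSpace ℝ (Fin 3) × ℝ) Φ θ
  have hX : ∀ y ∈ V, ∀ t, (mfderiv 𝓘(ℝ, EuclideanSpace ℝ (Fin 3) × ℝ) (𝓡 4) Φ (y, t)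
      ((0, 1) : EuclideanSpace ℝ (Fin 3) × ℝ) : EuclideanSpace ℝ (Fin 4)) =
      fundamentalField (Φ (y, t)) := by
    intro y hy t
    have hι : HasFDerivAt (fun r : ℝ => (y, r))
        (ContinuousLinearMap.inr ℝ (EuclideanSpace ℝ (Fin 3)) ℝ) t :=
      hasFDerivAt_prodMk_right y t
    have h₁ := mfderiv_comp (f := fun r : ℝ => (y, r)) t ((hΦ y hy t).mdifferentiableAt (by simp))
      hι.differentiableAt.mdifferentiableAt
    rw [mfderiv_eq_fderiv, hι.fderiv] at h₁
    refine Eq.trans ?_ (hπ.mfderiv_orbit (s y) t)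
    have h₂ := congrArg (fun l : ℝ →L[ℝ] EuclideanSpace ℝ (Fin 4) => l 1) h₁
    exact h₂.symm
  have hproj : ∀ y ∈ V, ∀ t, (mfderiv (𝓡 4) (𝓡 3) π (Φ (y, t))
      (mfderiv 𝓘(ℝ, EuclideanSpace ℝ (Fin 3) × ℝ) (𝓡 4) Φ (y, t)
        ((w, 0) : EuclideanSpace ℝ (Fin 3) × ℝ)) : EuclideanSpace ℝ (Fin 3)) =
      quotMkDeriv Γ y w := by
    intro y hy t
    have h₁ := mfderiv_comp (y, t) (hπ.contMDiff_proj.mdifferentiable (by simp) (Φ (y, t)))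
      ((hΦ y hy t).mdifferentiableAt (by simp))
    have h₂ : π ∘ Φ =ᶠ[𝓝 (y, t)] quotMk Γ ∘ Prod.fst := by
      filter_upwards [(hV.preimage continuous_fst).mem_nhds (show (y, t) ∈ Prod.fst ⁻¹' V from hy)]
        with q hq
      exact (hπ.proj_smul _ _).trans (hπs q.1 hq)
    have h₃ : (mfderiv 𝓘(ℝ, EuclideanSpace ℝ (Fin 3) × ℝ) (𝓡 3) (π ∘ Φ) (y, t) :
        EuclideanSpace ℝ (Fin 3) × ℝ →L[ℝ] EuclideanSpace ℝ (Fin 3)) =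
        mfderiv 𝓘(ℝ, EuclideanSpace ℝ (Fin 3) × ℝ) (𝓡 3) (quotMk Γ ∘ Prod.fst) (y, t) :=
      h₂.mfderiv_eq
    have h₄ := mfderiv_comp (I := 𝓘(ℝ, EuclideanSpace ℝ (Fin 3) × ℝ)) (f := Prod.fst) (y, t)
      ((contMDiff_quotMk (Γ := Γ)).mdifferentiable (by simp) y)
      (differentiableAt_fst (𝕜 := ℝ) (E := EuclideanSpace ℝ (Fin 3)) (F := ℝ)).mdifferentiableAt
    rw [mfderiv_eq_fderiv, fderiv_fst] at h₄
    exact congrArg (fun l : EuclideanSpace ℝ (Fin 3) × ℝ →L[ℝ] EuclideanSpace ℝ (Fin 3) =>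
      l (w, 0)) (h₁.symm.trans (h₃.trans h₄))
  refine ⟨V, s, ψ, hV, (hsm g hm₀.symm).1, hπs, fun y hy t => ?_, fun y hy t => ?_, fun y hy => ?_,
    fun y hy => ?_⟩
  · exact (contDiffAt_pullback hθ (hΦ y hy t)).differentiableAt (by simp)
  · have h := extDeriv_pullback_manifold hθ (hΦ y hy t)
    refine (congrArg (fun τ : (EuclideanSpace ℝ (Fin 3) × ℝ) [⋀^Fin 2]→L[ℝ] ℝ =>
      τ ![(w, 0), (0, 1)]) h).trans ?_
    have hq : quotMk Γ y = π (Φ (y, t)) := ((hπ.proj_smul _ _).trans (hπs y hy)).symm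
    refine Eq.trans ?_ (hT y (Φ (y, t)) hq _ (hproj y hy t))
    refine congrArg (DFunLike.coe (F := EuclideanSpace ℝ (Fin 4) [⋀^Fin 2]→L[ℝ] ℝ)
      (extD θ (Φ (y, t)))) ?_
    rw [← hX y hy t]
    ext i
    fin_cases i <;> rfl
  -- The parametrization is invariant under t ↦ t + 1, hence so is ψ; this makes the two sides of
  -- the cylinder cancel.
  · let τ : EuclideanSpace ℝ (Fin 3) × ℝ → EuclideanSpace ℝ (Fin 3) × ℝ := fun q => q + (0, 1)
    have hτ : HasFDerivAt τ (ContinuousLinearMap.id ℝ _) (y, 0) := (hasFDerivAt_id _).add_const _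
    have hτ₀ : τ (y, 0) = (y, 1) := by simp [τ]
    have hΦτ : Φ ∘ τ = Φ := by
      funext q
      change circlePath (q.2 + 1) • s (q.1 + 0) = circlePath q.2 • s q.1
      rw [circlePath_add, circlePath_one, mul_one, add_zero]
    have h := pullback_comp (E := EuclideanSpace ℝ (Fin 3) × ℝ) (M := EuclideanSpace ℝ (Fin 3) × ℝ)
      (f := τ) (x := (y, (0 : ℝ))) θ (g := Φ)
      (by rw [hτ₀]; exact (hΦ y hy 1).mdifferentiableAt (by simp))
      hτ.differentiableAt.mdifferentiableAt
    rw [hΦτ] at h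
    have h' : ψ (y, 0) = ψ (y, 1) := by
      refine h.trans ((pullback_vectorSpace τ ψ (y, 0)).trans ?_)
      rw [hτ.fderiv, hτ₀]
      rfl
    rw [h']
  · refine intervalIntegral.integral_congr fun t _ => ?_
    change θ (Φ (y, t)) ![fundamentalField (Φ (y, t))] = ψ (y, t) ![(0, 1)]
    refine congrArg (DFunLike.coe (F := EuclideanSpace ℝ (Fin 4) [⋀^Fin 1]→L[ℝ] ℝ)
      (θ (Φ (y, t)))) ?_
    rw [← hX y hy t]
    ext i
    fin_cases i
    rfl

/-- If the exterior derivative of a `1`-form is constant on the pairs formed by the lifts of a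
constant vector field of `G_k` and the fundamental field, then that constant vanishes. -/
theorem IsPrincipalCircleBundle.eq_zero_of_extD_eq [CompactSpace (Solv k ⧸ Γ)]
    (hπ : IsPrincipalCircleBundle π)
    {θ : DForm (EuclideanSpace ℝ (Fin 4)) M 1} (hθ : IsSmoothForm θ)
    {w : EuclideanSpace ℝ (Fin 3)} {T : ℝ}
    (hT : ∀ (g : EuclideanSpace ℝ (Fin 3)) (m : M), quotMk Γ g = π m →
      ∀ u : TangentSpace (𝓡 4) m,
        (mfderiv (𝓡 4) (𝓡 3) π m u : EuclideanSpace ℝ (Fin 3)) = quotMkDeriv Γ g w →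
        extD θ m ![u, fundamentalField m] = T) : T = 0 := by
  choose lift hlift using hπ.surjective
  let f : Solv k ⧸ Γ → ℝ := fun c => fibreIntegral θ (lift c)
  -- The choice of lift is immaterial: fibres are orbits, and the fibre integral is constant on
  -- orbits.
  have hf : ∀ m, f (π m) = fibreIntegral θ m := fun m => by
    obtain ⟨z, hz⟩ := hπ.exists_smul_eq (hlift (π m))
    exact (fibreIntegral_smul θ z _).symm.trans (congrArg _ hz)
  have hcont : Continuous f := by
    -- Upstairs `f` is locally a parametric integral with continuous integrand, and continuity
    -- descends through the quotient map.
    have : Continuous (f ∘ quotMk Γ) := by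
      rw [continuous_iff_continuousAt]
      intro g
      obtain ⟨V, s, ψ, hV, hg, hπs, hd, -, -, hint⟩ := hπ.exists_local_form hθ hT g
      have hon : ContinuousOn (fun y => ∫ t in (0 : ℝ)..1, ψ (y, t) ![(0, 1)]) V := by
        rw [continuousOn_iff_continuous_domRestrict]
        refine intervalIntegral.continuous_parametric_intervalIntegral_of_continuous'
          (f := fun (y : V) (t : ℝ) => ψ (y, t) ![(0, 1)]) ?_ 0 1
        rw [continuous_iff_continuousAt]
        rintro ⟨⟨y, hy⟩, t⟩
        have h₁ : ContinuousAt (fun q => ψ q ![(0, 1)]) (y, t) :=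
          (ContinuousAlternatingMap.apply ℝ (EuclideanSpace ℝ (Fin 3) × ℝ) ℝ
            ![(0, 1)]).continuous.continuousAt.comp (hd y hy t).continuousAt
        have h₂ : Continuous (fun q : V × ℝ => ((q.1 : EuclideanSpace ℝ (Fin 3)), q.2)) := by
          fun_prop
        exact ContinuousAt.comp (f := fun q : V × ℝ => ((q.1 : EuclideanSpace ℝ (Fin 3)), q.2))
          (x := (⟨y, hy⟩, t)) h₁ h₂.continuousAt
      refine (hon.continuousAt (hV.mem_nhds hg)).congr ?_
      filter_upwards [hV.mem_nhds hg] with y hy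
      rw [Function.comp_apply, ← hπs y hy, hf, hint y hy]
    exact (QuotientGroup.isQuotientMap_mk (N := Γ)).continuous_iff.2 this
  have hline : ∀ r : ℝ, f (quotMk Γ (r • w)) = f (quotMk Γ 0) + r * T := by
    -- Green's theorem applies only over short segments, inside the domain of one section;
    -- connectedness of ℝ makes the slope `T` global.
    have hloc : IsLocallyConstant fun r : ℝ => f (quotMk Γ (r • w)) - r * T := by
      rw [IsLocallyConstant.iff_eventually_eq]
      intro r
      obtain ⟨V, s, ψ, hV, hg, hπs, hd, hdT, hper, hint⟩ := hπ.exists_local_form hθ hT (r • w)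
      have hopen : IsOpen ((fun q : ℝ => r • w + q • w) ⁻¹' V) := hV.preimage (by fun_prop)
      obtain ⟨δ, hδ, hball⟩ := Metric.isOpen_iff.1 hopen 0 (by simpa using hg)
      filter_upwards [Metric.ball_mem_nhds r hδ] with r' hr'
      have hr : ∀ q ∈ uIcc 0 (r' - r), r • w + q • w ∈ V := by
        intro q hq
        refine hball ((convex_ball (0 : ℝ) δ).ordConnected.uIcc_subset
          (Metric.mem_ball_self hδ) ?_ hq)
        rw [Metric.mem_ball, Real.dist_eq, sub_zero, ← Real.dist_eq]
        exact hr'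
      have h := integral_eq_add_of_extDeriv_eq hd hdT hper hr
      have hend : r • w + (r' - r) • w = r' • w := by
        rw [← add_smul, add_sub_cancel]
      have hmem := hr _ right_mem_uIcc
      rw [hend] at hmem h
      rw [← hint _ hmem, ← hint _ hg, ← hf, ← hf, hπs _ hmem, hπs _ hg] at h
      rw [h]
      ring
    intro r
    have h := hloc.apply_eq_of_preconnectedSpace r 0
    simp only [zero_smul, zero_mul, sub_zero] at h
    linarith
  by_contra hne
  obtain ⟨C, hC⟩ := isCompact_univ.exists_bound_of_continuousOn hcont.continuousOn
  -- At this parameter `f` has grown by 2C + 1, more than the bound C on |f| allows.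
  have h₁ := hC (quotMk Γ (((2 * C + 1) / T) • w)) (mem_univ _)
  have h₂ := hC (quotMk Γ 0) (mem_univ _)
  rw [hline, div_mul_cancel₀ _ hne, Real.norm_eq_abs, abs_le] at h₁
  rw [Real.norm_eq_abs, abs_le] at h₂
  linarith [h₁.2, h₂.1]

end Primitive

/-! ### Lichnerowicz classes -/

section LichnerowiczClass

variable {E : Type*} [NormedAddCommGroup E] [NormedSpace ℝ E]
  {M : Type*} [TopologicalSpace M] [ChartedSpace E M]

theorem IsLCSWithLeeForm.mem_lichClosed {Ω : DForm E M 2} {τ : DForm E M 1}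
    (h : IsLCSWithLeeForm Ω τ) : Ω ∈ lichClosed τ 2 :=
  ⟨h.smooth, by rw [lichD, h.extD_eq, neg_add_cancel]⟩

theorem lichClass_ne_zero {τ : DForm E M 1} {p : ℕ} {θ : DForm E M p} (h : θ ∈ lichClosed τ p)
    (hne : θ ∉ lichExact τ p) : lichClass τ θ h ≠ 0 := by
  intro h₀
  rw [lichClass, Submodule.Quotient.mk_eq_zero] at h₀
  exact hne h₀

end LichnerowiczClass

/-! ### Non-exactness of the symplectic forms -/

section Coframe

variable {k : ℝ} {Γ : Subgroup (Solv k)} [DiscreteTopology Γ] [CompactSpace (Solv k ⧸ Γ)]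
  {M : Type*} [TopologicalSpace M] [ChartedSpace (EuclideanSpace ℝ (Fin 4)) M]
  [IsManifold (𝓡 4) ∞ M] [MulAction Circle M] {π : M → Solv k ⧸ Γ}

/-- The Lichnerowicz non-exactness of the forms in question: `w` is a constant vector field of
`G_k` on whose lifts the coframe takes the values `1, 0, 0`. -/
theorem lcsForm_notMem_lichExact (hπ : IsPrincipalCircleBundle π)
    {α β γ η : DForm (EuclideanSpace ℝ (Fin 4)) M 1} {w : EuclideanSpace ℝ (Fin 3)}
    (hw : ∀ (g : EuclideanSpace ℝ (Fin 3)) (m : M), quotMk Γ g = π m →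
      ∀ u : TangentSpace (𝓡 4) m,
        (mfderiv (𝓡 4) (𝓡 3) π m u : EuclideanSpace ℝ (Fin 3)) = quotMkDeriv Γ g w →
        α m ![u] = 1 ∧ β m ![u] = 0 ∧ γ m ![u] = 0)
    (hα : ∀ m, α m ![fundamentalField m] = 0) (hβ : ∀ m, β m ![fundamentalField m] = 0)
    (hγ : ∀ m, γ m ![fundamentalField m] = 0) (hη : ∀ m, η m ![fundamentalField m] = 1)
    {c l t₁ t₂ t₃ : ℝ} (ht₁ : t₁ ≠ 0) :
    t₁ • wedge α η + t₂ • wedge β γ + t₃ • (c • wedge α β - l • wedge γ η) ∉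
      lichExact (-(l • γ)) 2 := by
  rintro ⟨θ, hθ, hΩ⟩
  refine ht₁ (hπ.eq_zero_of_extD_eq hθ (w := w) fun g m hg u hu => ?_)
  obtain ⟨u₁, u₂, u₃⟩ := hw g m hg u hu
  -- Evaluated on a lift of `w` and the fundamental field, the Lee term vanishes because γ kills
  -- both vectors, and of Ω only t₁ α∧η survives.
  have h₁ := congrArg (fun τ : EuclideanSpace ℝ (Fin 4) [⋀^Fin 2]→L[ℝ] ℝ =>
    τ ![u, fundamentalField m]) (congrFun hΩ m)
  have h₂ : lichD (-(l • γ)) θ m ![u, fundamentalField m] = extD θ m ![u, fundamentalField m] +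
      (-(l * γ m ![u]) * θ m ![fundamentalField m] -
        -(l * γ m ![fundamentalField m]) * θ m ![u]) :=
    congrArg (extD θ m ![u, fundamentalField m] + ·) (wedge_apply_two _ _ m u _)
  have h₃ := h₂.symm.trans (h₁.trans (lcsForm_apply c l t₁ t₂ t₃ m u (fundamentalField m)))
  rw [u₁, u₂, u₃, hα, hβ, hγ, hη] at h₃
  linarith

end Coframe

end ACFM

end

/-! ### The two families -/

theorem theorem1 (k : ℝ) (hk : ∃ m : ℤ, m ≠ 2 ∧ Real.exp k + Real.exp (-k) = m)
    (Γ : Subgroup (ACFM.Solv k)) [DiscreteTopology Γ] [CompactSpace (ACFM.Solv k ⧸ Γ)]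
    (n : ℤ) (hn : n ≠ 0) (lam : ℝ)
    {M : Type*} [TopologicalSpace M] [T2Space M] [ChartedSpace (EuclideanSpace ℝ (Fin 4)) M]
    [IsManifold (𝓡 4) ∞ M] [MulAction Circle M]
    (π : M → ACFM.Solv k ⧸ Γ) (hπ : ACFM.IsPrincipalCircleBundle π)
    (α β γ η : ACFM.DForm (EuclideanSpace ℝ (Fin 4)) M 1)
    (hα : α = ACFM.pullback π (ACFM.descend Γ ACFM.Solv.alpha))
    (hβ : β = ACFM.pullback π (ACFM.descend Γ ACFM.Solv.beta))
    (hγ : γ = ACFM.pullback π (ACFM.descend Γ ACFM.Solv.gamma))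
    (hη : ACFM.IsConnectionForm η)
    (hcurv : ACFM.extD η = (n * lam) • ACFM.wedge α β) :
    (∀ t₁ t₂ t₃ : ℝ, t₁ * t₂ ≠ 0 → t₁ * t₂ ≠ n * k * lam * t₃ ^ 2 →
      ∀ Ω : ACFM.DForm (EuclideanSpace ℝ (Fin 4)) M 2,
        Ω = t₁ • ACFM.wedge α η + t₂ • ACFM.wedge β γ
          + t₃ • ((n * lam) • ACFM.wedge α β - k • ACFM.wedge γ η) →
        ACFM.IsLCSWithLeeForm Ω (-(k • γ)) ∧
        ∃ h : Ω ∈ ACFM.lichClosed (-(k • γ)) 2, ACFM.lichClass (-(k • γ)) Ω h ≠ 0) ∧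
    (∀ s₁ s₂ s₃ : ℝ, s₁ * s₂ ≠ 0 → s₁ * s₂ ≠ n * lam * k * s₃ ^ 2 →
      ∀ Ω : ACFM.DForm (EuclideanSpace ℝ (Fin 4)) M 2,
        Ω = s₁ • ACFM.wedge β η + s₂ • ACFM.wedge α γ
          + s₃ • ((n * lam) • ACFM.wedge α β + k • ACFM.wedge γ η) →
        ACFM.IsLCSWithLeeForm Ω (k • γ) ∧
        ∃ h : Ω ∈ ACFM.lichClosed (k • γ) 2, ACFM.lichClass (k • γ) Ω h ≠ 0) := by
  have iα := ACFM.Solv.isRightInvariant_alpha (k := k)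
  have iβ := ACFM.Solv.isRightInvariant_beta (k := k)
  have iγ := ACFM.Solv.isRightInvariant_gamma (k := k)
  have nα := ACFM.isSmoothForm_descend (Γ := Γ) iα ACFM.Solv.contDiff_coordForm_alpha
  have nβ := ACFM.isSmoothForm_descend (Γ := Γ) iβ ACFM.Solv.contDiff_coordForm_beta
  have nγ := ACFM.isSmoothForm_descend (Γ := Γ) iγ ACFM.Solv.contDiff_coordForm_gamma
  have sα : ACFM.IsSmoothForm α := hα ▸ nα.pullback hπ.contMDiff_proj
  have sβ : ACFM.IsSmoothForm β := hβ ▸ nβ.pullback hπ.contMDiff_proj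
  have sγ : ACFM.IsSmoothForm γ := hγ ▸ nγ.pullback hπ.contMDiff_proj
  have dα : ACFM.extD α = (-k) • ACFM.wedge α γ := by
    rw [hα, hγ, ← ACFM.pullback_wedge]
    funext m
    rw [ACFM.extD_pullback nα hπ.contMDiff_proj.contMDiffAt, ACFM.extD_descend_alpha]
    rfl
  have dβ : ACFM.extD β = k • ACFM.wedge β γ := by
    rw [hβ, hγ, ← ACFM.pullback_wedge]
    funext m
    rw [ACFM.extD_pullback nβ hπ.contMDiff_proj.contMDiffAt, ACFM.extD_descend_beta]
    rfl
  have dγ : ACFM.extD γ = 0 := by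
    rw [hγ]
    funext m
    rw [ACFM.extD_pullback nγ hπ.contMDiff_proj.contMDiffAt, ACFM.extD_descend_gamma]
    rfl
  have hsurj : ∀ (x : M) (a b c d : ℝ), ∃ v : TangentSpace (𝓡 4) x,
      α x ![v] = a ∧ β x ![v] = b ∧ γ x ![v] = c ∧ η x ![v] = d := by
    rw [hα, hβ, hγ]
    exact ACFM.exists_coframe_eq hπ hη
  have vα : ∀ m, α m ![ACFM.fundamentalField m] = 0 :=
    hα ▸ ACFM.pullback_descend_fundamentalField hπ _
  have vβ : ∀ m, β m ![ACFM.fundamentalField m] = 0 :=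
    hβ ▸ ACFM.pullback_descend_fundamentalField hπ _
  have vγ : ∀ m, γ m ![ACFM.fundamentalField m] = 0 :=
    hγ ▸ ACFM.pullback_descend_fundamentalField hπ _
  refine ⟨fun t₁ t₂ t₃ h₁₂ h₃ Ω hΩ => ?_, fun t₁ t₂ t₃ h₁₂ h₃ Ω hΩ => ?_⟩
  · subst hΩ
    have hlcs := ACFM.isLCSWithLeeForm_of_structure_equations sα sβ sγ hη.smooth dα dβ dγ hcurv
      hsurj h₁₂ (t₃ := t₃) (by convert h₃ using 1; ring)
    -- The direction is ∂/∂x, on which α, β, γ take the values 1, 0, 0 at every point of `G_k`.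
    refine ⟨hlcs, hlcs.mem_lichClosed, ACFM.lichClass_ne_zero _
      (ACFM.lcsForm_notMem_lichExact hπ (w := EuclideanSpace.single 0 1) ?_ vα vβ vγ
        hη.apply_fundamentalField (left_ne_zero_of_mul h₁₂))⟩
    intro g m hg u hu
    rw [hα, hβ, hγ, ACFM.pullback_descend_apply iα hg hu, ACFM.pullback_descend_apply iβ hg hu,
      ACFM.pullback_descend_apply iγ hg hu]
    simp [ACFM.Solv.coordForm_alpha_apply, ACFM.Solv.coordForm_beta_apply,
      ACFM.Solv.coordForm_gamma_apply]
  -- The roles of α and β are exchanged, with -k for k and -nλ for nλ. The structure equations keep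
  -- their shape and the product of the two constants in the non-degeneracy condition is unchanged.
  · have hcurv' : ACFM.extD η = (-(n * lam)) • ACFM.wedge β α := by
      rw [hcurv, ACFM.wedge_swap α β, smul_neg, neg_smul]
    have hΩ' : Ω = t₁ • ACFM.wedge β η + t₂ • ACFM.wedge α γ
        + t₃ • ((-(n * lam)) • ACFM.wedge β α - (-k) • ACFM.wedge γ η) := by
      rw [hΩ, ACFM.wedge_swap α β, smul_neg, neg_smul, neg_smul, sub_neg_eq_add]
    have hk' : k • γ = -((-k) • γ) := by rw [neg_smul, neg_neg]
    subst hΩ'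
    rw [hk']
    have hlcs := ACFM.isLCSWithLeeForm_of_structure_equations sβ sα sγ hη.smooth
      (k := -k) (by rw [neg_neg]; exact dβ) dα dγ hcurv'
      (fun x a b c d => (hsurj x b a c d).imp fun v hv => ⟨hv.2.1, hv.1, hv.2.2⟩) h₁₂
      (t₃ := t₃) (by convert h₃ using 1; ring)
    refine ⟨hlcs, hlcs.mem_lichClosed, ACFM.lichClass_ne_zero _
      (ACFM.lcsForm_notMem_lichExact hπ (w := EuclideanSpace.single 1 1) ?_ vβ vα vγ
        hη.apply_fundamentalField (left_ne_zero_of_mul h₁₂))⟩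
    intro g m hg u hu
    rw [hα, hβ, hγ, ACFM.pullback_descend_apply iα hg hu, ACFM.pullback_descend_apply iβ hg hu,
      ACFM.pullback_descend_apply iγ hg hu]
    simp [ACFM.Solv.coordForm_alpha_apply, ACFM.Solv.coordForm_beta_apply,
      ACFM.Solv.coordForm_gamma_apply]
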